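/- All rings are associative with identity and modules are unitary left modules. Let $A$ be a ring and $M$ an $A$-module. A finite quasi-projective resolution of $M$ is a bounded complex $P_\bullet$ (with differentials $P_i\to P_{i-1}$, $i\in\mathbb Z$) of projective $A$-modules for which there are integers $n_j\ge 0$ ($j\in\mathbb Z$), not all zero, with $H_j(P_\bullet)\cong M^{n_j}$ for all $j$. For $M\neq 0$, the quasi-projective dimension $\operatorname{qpd}_A M\in\mathbb N\cup\{\infty\}$ is the infimum of $$\sup\{i\mid P_i\ne 0\}-\sup\{i\mid H_i(P_\bullet)\neq 0\}$$ over all finite quasi-projective resolutions $P_\bullet$ of $M$ (and $\infty$ if there are none); $\operatorname{qpd}_A 0=0$. Write $\operatorname{pd}_A M$ for the projective dimension of $M$, with $\operatorname{pd}_A 0=0$. For a left Noetherian ring $A$ put $$\operatorname{fdim} A=\sup\{\operatorname{pd}_A M\mid M \text{ finitely generated},\ \operatorname{pd}_A M<\infty\},\qquad \operatorname{qgldim} A=\sup\{\operatorname{qpd}_A M\mid M\text{ finitely generated}\}.$$ **Proposition.** Let $R$ and $S$ be left Noetherian rings. Then: 1. $\operatorname{fdim} R=\sup\{\operatorname{qpd}_R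 M\mid M\text{ a finitely generated } R\text{-module with }\operatorname{qpd}_R M<\infty\}$. In particular, if $\operatorname{qgldim} R<\infty$, then $\operatorname{fdim} R=\operatorname{qgldim} R$. 2. If $R$ and $S$ are Morita equivalent, then $\operatorname{qgldim} R=\operatorname{qgldim} S$. 3. $\operatorname{qgldim}(R\times S)=\max\{\operatorname{qgldim} R,\operatorname{qgldim} S\}$. 4. If moreover $R$ and $S$ are nonzero finite-dimensional algebras over a field $K$, then $\operatorname{qgldim}(R\otimes_K S)\ge\max\{\operatorname{qgldim} R,\operatorname{qgldim} S\}$. -/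

import Mathlib

open CategoryTheory CategoryTheory.Limits
open scoped TensorProduct

universe u v w

noncomputable section

namespace QuasiProj

section Abelian

attribute [local instance] Abelian.hasFiniteBiproducts

variable {C : Type w} [Category.{v} C] [Abelian C]

/-- `P` is a quasi-projective resolution of `M`: a bounded below complex of projective objects
whose homology objects are finite direct sums of copies of `M`, with multiplicities that are
not all zero. (Complexes are indexed homologically, the differential lowering the degree.) -/
structure IsQuasiProjectiveResolution (P : ChainComplex C ℤ) (M : C) : Prop where
  boundedBelow : ∃ a : ℤ, ∀ i : ℤ, i < a → IsZero (P.X i)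
  projective : ∀ i : ℤ, Projective (P.X i)
  homology : ∃ n : ℤ → ℕ, (∃ j : ℤ, n j ≠ 0) ∧
    ∀ j : ℤ, Nonempty (P.homology j ≅ ⨁ (fun _ : Fin (n j) => M))

/-- A finite quasi-projective resolution: one that is also bounded above. -/
structure IsFiniteQuasiProjectiveResolution (P : ChainComplex C ℤ) (M : C) : Prop
    extends IsQuasiProjectiveResolution P M where
  boundedAbove : ∃ b : ℤ, ∀ i : ℤ, b < i → IsZero (P.X i)

/-- The supremum of the degrees in which the complex is nonzero. It is only used for bounded
complexes with some nonzero term, where it is the largest such degree. -/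
def complexSup (P : ChainComplex C ℤ) : ℤ :=
  sSup {i : ℤ | ¬ IsZero (P.X i)}

/-- The supremum of the degrees in which the homology is nonzero. It is only used for bounded
complexes with some nonzero homology, where it is the largest such degree. -/
def homologySup (P : ChainComplex C ℤ) : ℤ :=
  sSup {i : ℤ | ¬ IsZero (P.homology i)}

open Classical in
/-- The quasi-projective dimension of an object: zero for a zero object, and otherwise the infimum
of `sup P - hsup P` over all finite quasi-projective resolutions `P`, which is `⊤` if there are
none. For a finite quasi-projective resolution of a nonzero object both suprema are attained and
`hsup P ≤ sup P`, see `homologySup_le_complexSup`, so that `Int.toNat` changes nothing. -/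
def qpd (M : C) : ℕ∞ :=
  if IsZero M then 0
  else ⨅ (P : ChainComplex C ℤ) (_ : IsFiniteQuasiProjectiveResolution P M),
    ((complexSup P - homologySup P).toNat : ℕ∞)

theorem isGreatest_homologySup {P : ChainComplex C ℤ} {M : C} (hM : ¬ IsZero M)
    (h : IsFiniteQuasiProjectiveResolution P M) :
    IsGreatest {i : ℤ | ¬ IsZero (P.homology i)} (homologySup P) := by
  obtain ⟨b, hb⟩ := h.boundedAbove
  obtain ⟨n, ⟨j, hj⟩, hn⟩ := h.homology
  have hne : {i : ℤ | ¬ IsZero (P.homology i)}.Nonempty := by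
    refine ⟨j, fun hz => hM ?_⟩
    have hz' : IsZero (⨁ (fun _ : Fin (n j) => M)) := hz.of_iso (hn j).some.symm
    exact hz'.of_mono (biproduct.ι (fun _ : Fin (n j) => M) ⟨0, Nat.pos_of_ne_zero hj⟩)
  have hbdd : BddAbove {i : ℤ | ¬ IsZero (P.homology i)} := by
    refine ⟨b, fun i hi => ?_⟩
    by_contra hlt
    exact hi ((P.sc i).exact_iff_isZero_homology.1
      (ShortComplex.exact_of_isZero_X₂ _ (hb i (not_le.1 hlt))))
  exact ⟨Int.csSup_mem hne hbdd, fun _ hi => le_csSup hbdd hi⟩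

theorem isGreatest_complexSup {P : ChainComplex C ℤ} {M : C} (hM : ¬ IsZero M)
    (h : IsFiniteQuasiProjectiveResolution P M) :
    IsGreatest {i : ℤ | ¬ IsZero (P.X i)} (complexSup P) := by
  obtain ⟨b, hb⟩ := h.boundedAbove
  have hne : {i : ℤ | ¬ IsZero (P.X i)}.Nonempty :=
    ⟨homologySup P, fun hz => (isGreatest_homologySup hM h).1
      ((P.sc _).exact_iff_isZero_homology.1
      (ShortComplex.exact_of_isZero_X₂ _ hz))⟩
  have hbdd : BddAbove {i : ℤ | ¬ IsZero (P.X i)} := by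
    refine ⟨b, fun i hi => ?_⟩
    by_contra hlt
    exact hi (hb i (not_le.1 hlt))
  exact ⟨Int.csSup_mem hne hbdd, fun _ hi => le_csSup hbdd hi⟩

theorem homologySup_le_complexSup {P : ChainComplex C ℤ} {M : C} (hM : ¬ IsZero M)
    (h : IsFiniteQuasiProjectiveResolution P M) : homologySup P ≤ complexSup P :=
  (isGreatest_complexSup hM h).2 fun hz => (isGreatest_homologySup hM h).1
    ((P.sc _).exact_iff_isZero_homology.1
      (ShortComplex.exact_of_isZero_X₂ _ hz))

end Abelian

section Rings

variable (R : Type u) [Ring R]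

/-- The projective dimension of a left `R`-module, with the convention that the zero module
has projective dimension `0` (Mathlib's `projectiveDimension` takes the value `⊥` there). -/
def pd (M : ModuleCat.{u} R) : ℕ∞ :=
  (projectiveDimension M).unbotD 0

/-- The finitistic dimension: the supremum of the projective dimensions of the finitely generated
left modules of finite projective dimension. -/
def fdim : ℕ∞ :=
  ⨆ (M : ModuleCat.{u} R) (_ : Module.Finite R M) (_ : pd R M < ⊤), pd R M

/-- The quasi-global dimension: the supremum of the quasi-projective dimensions, in the category
of all left modules, of the finitely generated left modules. -/
def qgldim : ℕ∞ :=
  ⨆ (M : ModuleCat.{u} R) (_ : Module.Finite R M), qpd M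

end Rings

end QuasiProj

end

/-! For a complex P of projectives write C_i for the cokernel of P_{i+1} → P_i (`P.opcycles i`) and
B_i for the image of that differential. Everything about dimensions comes from the two sequences 0 →
B_i → P_i → C_i → 0 and 0 → H_{i+1} → C_{i+1} → B_i → 0 (`exists_shortExact_opcycles`). If t is the
top homology degree, the C_i with i > t are iterated syzygies of C_t, so the part of P above t can
be cut down to any length bounding pd C_t (`qpd_le_of_hasProjectiveDimensionLT_opcycles`).

If M is finitely generated with qpd M < ∞, then C_t has finite projective dimension. The P_i may be
large, but by Schanuel's lemma C_t is finitely generated up to projective summands. Hence pd C_t ≤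
fdim R, and cutting gives qpd M ≤ fdim R. Conversely, if pd M < ∞ then qpd M < ∞, and pd M ≤ qpd M:
if pd M exceeded pd C_t, the sequences would force a smaller projective dimension on H_t, of which M
is a summand. This gives the formula for `fdim`.

The other parts rest on exact functors preserving projectives, which do not raise qpd
(`qpd_map_le`), and on qpd N ≤ qpd (N^d) for d ≠ 0. The functors are equivalences, restriction and
coextension along the projections of a product, and restriction along R → R ⊗ S. The upper bound for
products also needs `qpd_biprod_le`. -/

noncomputable section

namespace QuasiProj

section Abelian

attribute [local instance] Abelian.hasFiniteBiproducts

variable {C : Type w} [Category.{v} C] [Abelian C]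

/-! ### Finite powers of an object -/

/-- `Z` is isomorphic to the direct sum of `n` copies of `M`. -/
def IsPower (M Z : C) (n : ℕ) : Prop :=
  Nonempty (Z ≅ ⨁ (fun _ : Fin n => M))

theorem IsPower.of_biproduct {M Z : C} {J : Type} [Finite J]
    (e : Z ≅ ⨁ (fun _ : J => M)) : IsPower M Z (Nat.card J) :=
  ⟨e ≪≫ biproduct.whiskerEquiv (f := fun _ : J => M) (g := fun _ : Fin (Nat.card J) => M)
    (Finite.equivFin J) (fun _ => Iso.refl _)⟩

theorem IsPower.one (M : C) : IsPower M M 1 :=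
  ⟨(biproductUniqueIso (fun _ : Fin 1 => M)).symm⟩

theorem IsPower.of_iso {M Z Z' : C} {n : ℕ} (h : IsPower M Z n) (e : Z' ≅ Z) : IsPower M Z' n :=
  ⟨e ≪≫ h.some⟩

theorem IsPower.of_base_iso {M M' Z : C} {n : ℕ} (h : IsPower M Z n) (e : M ≅ M') :
    IsPower M' Z n :=
  ⟨h.some ≪≫ biproduct.mapIso fun _ => e⟩

theorem IsPower.biproduct {M : C} {J : Type} [Finite J] {Z : J → C} {n : J → ℕ}
    (h : ∀ j, IsPower M (Z j) (n j)) : IsPower M (⨁ Z) (Nat.card (Σ j, Fin (n j))) :=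
  .of_biproduct (biproduct.mapIso (fun j => (h j).some) ≪≫
    biproductBiproductIso (fun j => Fin (n j)) (fun _ _ => M))

theorem IsPower.biprod {X Y Z W : C} {n : ℕ} (hX : IsPower X Z n) (hY : IsPower Y W n) :
    IsPower (X ⊞ Y) (Z ⊞ W) n :=
  ⟨biprod.mapIso hX.some hY.some ≪≫
    { hom := biprod.desc (biproduct.map fun _ => biprod.inl) (biproduct.map fun _ => biprod.inr)
      inv := biprod.lift (biproduct.map fun _ => biprod.fst) (biproduct.map fun _ => biprod.snd)
      hom_inv_id := by
        ext <;> simp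
      inv_hom_id := by
        ext <;> simp [biprod.lift_desc] }⟩

theorem IsPower.power {M N Z : C} {d n : ℕ} (hN : IsPower M N d) (hZ : IsPower N Z n) :
    IsPower M Z (n * d) := by
  have h := (IsPower.biproduct (fun _ : Fin n => hN)).of_iso hZ.some
  simpa using h

theorem IsPower.isZero_iff {M Z : C} {n : ℕ} (h : IsPower M Z n) :
    IsZero Z ↔ n = 0 ∨ IsZero M := by
  rw [h.some.isZero_iff]
  constructor
  · intro hz
    refine or_iff_not_imp_left.2 fun hn => ?_
    exact hz.of_mono (biproduct.ι (fun _ : Fin n => M) ⟨0, Nat.pos_of_ne_zero hn⟩)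
  · rintro (rfl | hM)
    · rw [IsZero.iff_id_eq_zero]
      ext j
      exact j.elim0
    · rw [IsZero.iff_id_eq_zero]
      ext j
      exact hM.eq_of_src _ _

theorem IsPower.retract {M Z : C} {n : ℕ} (h : IsPower M Z n) (hn : n ≠ 0) :
    Nonempty (Retract M Z) :=
  ⟨{ i := biproduct.ι (fun _ : Fin n => M) ⟨0, Nat.pos_of_ne_zero hn⟩ ≫ h.some.inv
     r := h.some.hom ≫ biproduct.π (fun _ : Fin n => M) ⟨0, Nat.pos_of_ne_zero hn⟩ }⟩

theorem IsPower.map {D : Type*} [Category* D] [Abelian D] (F : C ⥤ D) [F.Additive] {M Z : C}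
    {n : ℕ} (h : IsPower M Z n) : IsPower (F.obj M) (F.obj Z) n :=
  ⟨F.mapIso h.some ≪≫ F.mapBiproduct _⟩

theorem IsPower.hasProjectiveDimensionLT {M Z : C} {n : ℕ} (h : IsPower M Z n) (k : ℕ)
    (hM : HasProjectiveDimensionLT M k) : HasProjectiveDimensionLT Z k := by
  let := HasExt.standard C
  suffices HasProjectiveDimensionLT (⨁ (fun _ : Fin n => M)) k from
    hasProjectiveDimensionLT_of_iso h.some.symm k
  rw [hasProjectiveDimensionLT_iff]
  intro i hi Y e
  apply (Abelian.Ext.biproductAddEquiv (biproduct.isBilimit (fun _ : Fin n => M)) Y i).injective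
  ext j
  exact (Abelian.Ext.eq_zero_of_hasProjectiveDimensionLT _ k hi).trans
    (Abelian.Ext.eq_zero_of_hasProjectiveDimensionLT _ k hi).symm

/-! ### Bounds for the quasi-projective dimension -/

theorem IsFiniteQuasiProjectiveResolution.of_iso {P : ChainComplex C ℤ} {M M' : C}
    (h : IsFiniteQuasiProjectiveResolution P M) (e : M ≅ M') :
    IsFiniteQuasiProjectiveResolution P M' where
  boundedBelow := h.boundedBelow
  boundedAbove := h.boundedAbove
  projective := h.projective
  homology := by
    obtain ⟨n, hn, h⟩ := h.homology
    exact ⟨n, hn, fun j => IsPower.of_base_iso (h j) e⟩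

theorem qpd_of_isZero {M : C} (hM : IsZero M) : qpd M = 0 := if_pos hM

/-- Neither `b` nor `t` has to be optimal: any upper bound for the complex and any degree with
nonzero homology will do. -/
theorem qpd_le_of_resolution {P : ChainComplex C ℤ} {M : C} (hM : ¬ IsZero M)
    (h : IsFiniteQuasiProjectiveResolution P M) {b t : ℤ} {d : ℕ}
    (hb : ∀ i, b < i → IsZero (P.X i)) (ht : ¬ IsZero (P.homology t)) (hd : b - t ≤ d) :
    qpd M ≤ d := by
  rw [qpd, if_neg hM]
  refine (iInf₂_le P h).trans ?_
  have h1 := (isGreatest_homologySup hM h).2 ht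
  have h2 : complexSup P ≤ b := by
    by_contra! hlt
    exact (isGreatest_complexSup hM h).1 (hb _ hlt)
  exact_mod_cast (by lia : (complexSup P - homologySup P).toNat ≤ d)

theorem exists_resolution_of_qpd_le {M : C} (hM : ¬ IsZero M) {d : ℕ} (hd : qpd M ≤ d) :
    ∃ P : ChainComplex C ℤ, IsFiniteQuasiProjectiveResolution P M ∧
      complexSup P - homologySup P ≤ d := by
  rw [qpd, if_neg hM] at hd
  have hd' := hd.trans_lt (ENat.natCast_lt_natCast.2 (Nat.lt_succ_self d))
  simp only [iInf_lt_iff] at hd'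
  obtain ⟨P, hP, hlt⟩ := hd'
  refine ⟨P, hP, ?_⟩
  have := ENat.natCast_lt_natCast.1 hlt
  lia

theorem qpd_le_of_forall {M : C} (hM : ¬ IsZero M) {x : ℕ∞}
    (h : ∀ (P : ChainComplex C ℤ) (d : ℕ), IsFiniteQuasiProjectiveResolution P M →
      complexSup P - homologySup P ≤ d → x ≤ d) : x ≤ qpd M := by
  rw [qpd, if_neg hM]
  exact le_iInf₂ fun P hP => h P _ hP (Int.self_le_toNat _)

theorem IsFiniteQuasiProjectiveResolution.isZero_X {P : ChainComplex C ℤ} {M : C}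
    (hM : ¬ IsZero M) (h : IsFiniteQuasiProjectiveResolution P M) {i : ℤ}
    (hi : complexSup P < i) : IsZero (P.X i) := by
  by_contra hz
  exact absurd ((isGreatest_complexSup hM h).2 hz) (not_le.2 hi)

theorem qpd_eq_of_iso {M M' : C} (e : M ≅ M') : qpd M = qpd M' := by
  have : ∀ P : ChainComplex C ℤ, IsFiniteQuasiProjectiveResolution P M ↔
      IsFiniteQuasiProjectiveResolution P M' := fun P => ⟨fun h => h.of_iso e,
        fun h => h.of_iso e.symm⟩
  by_cases hM : IsZero M
  · rw [qpd_of_isZero hM, qpd_of_isZero (e.isZero_iff.1 hM)]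
  · rw [qpd, qpd, if_neg hM, if_neg fun h => hM (e.isZero_iff.2 h)]
    simp only [this]

/-- A resolution of M^d is also one of M, with all multiplicities multiplied by d. The tensor
product bound uses this with d = dim_K S. -/
theorem qpd_le_qpd_of_isPower {M N : C} {d : ℕ} (h : IsPower M N d) (hd : d ≠ 0) :
    qpd M ≤ qpd N := by
  by_cases hM : IsZero M
  · simp [qpd_of_isZero hM]
  have hN : ¬ IsZero N := fun hN => (h.isZero_iff.1 hN).elim hd hM
  refine qpd_le_of_forall hN fun P k hP hk => ?_
  refine qpd_le_of_resolution hM ⟨⟨hP.boundedBelow, hP.projective, ?_⟩, hP.boundedAbove⟩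
    (fun i hi => hP.isZero_X hN hi) (isGreatest_homologySup hN hP).1 hk
  obtain ⟨n, ⟨j, hj⟩, hn⟩ := hP.homology
  exact ⟨fun j => n j * d, ⟨j, mul_ne_zero hj hd⟩, fun j => h.power (hn j)⟩

/-- An exact functor keeps the multiplicities of the homology, so if F M ≠ 0 the top homology degree
is unchanged, while the complex can only become shorter. -/
theorem qpd_map_le {D : Type*} [Category* D] [Abelian D] (F : C ⥤ D) [F.Additive]
    [F.PreservesHomology] (hF : ∀ P : C, Projective P → Projective (F.obj P)) (M : C) :
    qpd (F.obj M) ≤ qpd M := by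
  by_cases hFM : IsZero (F.obj M)
  · simp [qpd_of_isZero hFM]
  have hM : ¬ IsZero M := fun hM => hFM (F.map_isZero hM)
  refine qpd_le_of_forall hM fun P k hP hk => ?_
  let Q := (F.mapHomologicalComplex (ComplexShape.down ℤ)).obj P
  have eQ : ∀ j, Q.homology j ≅ F.obj (P.homology j) := fun j => (P.sc j).mapHomologyIso F
  have hQ : ∀ i, IsZero (P.X i) → IsZero (Q.X i) := fun i hi => F.map_isZero hi
  obtain ⟨n, ⟨j, hj⟩, hn⟩ := hP.homology
  refine qpd_le_of_resolution (P := Q) hFM ⟨⟨?_, fun i => hF _ (hP.projective i), ?_⟩, ?_⟩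
    (fun i hi => hQ i (hP.isZero_X hM hi)) (t := homologySup P) ?_ hk
  · obtain ⟨a, ha⟩ := hP.boundedBelow
    exact ⟨a, fun i hi => hQ i (ha i hi)⟩
  · exact ⟨n, ⟨j, hj⟩, fun j => (IsPower.map F (hn j)).of_iso (eQ j)⟩
  · obtain ⟨a, ha⟩ := hP.boundedAbove
    exact ⟨a, fun i hi => hQ i (ha i hi)⟩
  · have hp : IsPower _ _ _ := hn (homologySup P)
    have h0 : ¬ (n (homologySup P) = 0 ∨ IsZero M) :=
      fun h0 => (isGreatest_homologySup hM hP).1 (hp.isZero_iff.2 h0)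
    rw [((hp.map F).of_iso (eQ _)).isZero_iff]
    tauto

end Abelian

section Abelian

attribute [local instance] Abelian.hasFiniteBiproducts

variable {C : Type w} [Category.{v} C] [Abelian C]

/-! ### Syzygies in a complex -/

/-- The object `K.opcycles (i + 1)` is an extension of the first syzygy `B` of `K.opcycles i`
by the homology of `K`. -/
theorem exists_shortExact_opcycles (K : ChainComplex C ℤ) (i : ℤ) :
    ∃ (B : C) (f : K.opcycles (i + 1) ⟶ B) (g : B ⟶ K.X i)
      (wf : K.homologyι (i + 1) ≫ f = 0) (wg : g ≫ K.pOpcycles i = 0),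
      (ShortComplex.mk _ _ wf).ShortExact ∧ (ShortComplex.mk _ _ wg).ShortExact := by
  have hφ : K.fromOpcycles (i + 1) i ≫ K.pOpcycles i = 0 := by
    simp [← cancel_epi (K.pOpcycles (i + 1))]
  let f := kernel.lift (K.pOpcycles i) _ hφ
  have hf : f ≫ kernel.ι (K.pOpcycles i) = K.fromOpcycles (i + 1) i := kernel.lift_ι _ _ _
  have hprev : (ComplexShape.down ℤ).prev i = i + 1 := (ComplexShape.down ℤ).prev_eq' rfl
  have hex : (ShortComplex.mk (K.d (i + 1) i) (K.pOpcycles i) (by simp)).Exact :=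
    ShortComplex.exact_of_g_is_cokernel _ (K.opcyclesIsCokernel (i + 1) i hprev)
  have hepi : Epi f := by
    have h1 : Epi (kernel.lift (K.pOpcycles i) (K.d (i + 1) i) (by simp)) :=
      hex.epi_kernelLift
    have h2 : kernel.lift (K.pOpcycles i) (K.d (i + 1) i) (by simp) = K.pOpcycles (i + 1) ≫ f := by
      simp [← cancel_mono (kernel.ι (K.pOpcycles i)), hf]
    rw [h2] at h1
    exact epi_of_epi (K.pOpcycles (i + 1)) f
  have wf : K.homologyι (i + 1) ≫ f = 0 := by
    simp [← cancel_mono (kernel.ι (K.pOpcycles i)), hf]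
  refine ⟨_, f, kernel.ι _, wf, by simp, ?_, ?_⟩
  · have hex2 : (ShortComplex.mk (K.homologyι (i + 1)) (K.fromOpcycles (i + 1) i)
        (by simp)).Exact :=
      ShortComplex.exact_of_f_is_kernel _
        (K.homologyIsKernel (i + 1) i ((ComplexShape.down ℤ).next_eq' rfl))
    let φ : ShortComplex.mk _ _ wf ⟶ ShortComplex.mk (K.homologyι (i + 1))
        (K.fromOpcycles (i + 1) i) (by simp) :=
      { τ₁ := 𝟙 _, τ₂ := 𝟙 _, τ₃ := kernel.ι _ }
    have : Epi φ.τ₁ := inferInstanceAs (Epi (𝟙 _))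
    have : IsIso φ.τ₂ := inferInstanceAs (IsIso (𝟙 _))
    have : Mono φ.τ₃ := inferInstanceAs (Mono (kernel.ι _))
    exact { exact := (ShortComplex.exact_iff_of_epi_of_isIso_of_mono φ).2 hex2
            mono_f := inferInstanceAs (Mono (K.homologyι (i + 1)))
            epi_g := hepi }
  · exact { exact := ShortComplex.exact_kernel _
            mono_f := inferInstanceAs (Mono (kernel.ι _))
            epi_g := inferInstanceAs (Epi (K.pOpcycles i)) }

/-- If the homology vanishes in degree `i + 1`, then `K.opcycles (i + 1)` is a syzygy of
`K.opcycles i`. -/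
theorem exists_shortExact_of_isZero_homology (K : ChainComplex C ℤ) (i : ℤ)
    (h : IsZero (K.homology (i + 1))) :
    ∃ (f : K.opcycles (i + 1) ⟶ K.X i) (w : f ≫ K.pOpcycles i = 0),
      (ShortComplex.mk _ _ w).ShortExact := by
  obtain ⟨B, f, g, wf, wg, hf, hg⟩ := exists_shortExact_opcycles K i
  have : IsIso f := hf.isIso_g_iff.2 h
  refine ⟨f ≫ g, by simp [wg], ?_⟩
  refine ShortComplex.shortExact_of_iso (S₁ := ShortComplex.mk _ _ wg) ?_ hg
  exact ShortComplex.isoMk (asIso f).symm (Iso.refl _) (Iso.refl _) (by simp) (by simp)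

/-- Each step up above the top homology degree replaces C_i by a syzygy. With `f = 0` the conclusion
is that C_{t+k} is projective. -/
theorem hasProjectiveDimensionLT_opcycles_add (K : ChainComplex C ℤ)
    (hK : ∀ i, Projective (K.X i)) {t : ℤ} (ht : ∀ i, t < i → IsZero (K.homology i)) (f k : ℕ)
    (h : HasProjectiveDimensionLT (K.opcycles t) (f + k + 1)) :
    HasProjectiveDimensionLT (K.opcycles (t + k)) (f + 1) := by
  induction k generalizing f with
  | zero => simpa using h
  | succ k ih =>
    have := ih (f + 1) (by rwa [show f + 1 + k + 1 = f + (k + 1) + 1 by lia])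
    obtain ⟨g, w, hg⟩ := exists_shortExact_of_isZero_homology K (t + k) (ht _ (by lia))
    have := (hg.hasProjectiveDimensionLT_X₃_iff f (hK _)).1 this
    rwa [Nat.cast_succ, ← add_assoc]

/-- The terms in degrees b, …, b - k form a projective resolution of C_{b-k} of length k. -/
theorem hasProjectiveDimensionLT_opcycles_sub (K : ChainComplex C ℤ)
    (hK : ∀ i, Projective (K.X i)) {b : ℤ} (k : ℕ) (hb : ∀ i, b < i → IsZero (K.X i))
    (ht : ∀ i, b - k < i → IsZero (K.homology i)) :
    HasProjectiveDimensionLT (K.opcycles (b - k)) (k + 1) := by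
  induction k with
  | zero =>
    have : IsIso (K.pOpcycles b) := K.isIso_pOpcycles (b + 1) b
      ((ComplexShape.down ℤ).prev_eq' rfl) ((hb _ (by lia)).eq_of_src _ _)
    have := Projective.of_iso (asIso (K.pOpcycles b)) (hK b)
    simp only [Nat.cast_zero, sub_zero]
    infer_instance
  | succ k ih =>
    have := ih fun i hi => ht i (by lia)
    have hi : b - (k + 1 : ℕ) + 1 = b - k := by lia
    obtain ⟨g, w, hg⟩ := exists_shortExact_of_isZero_homology K (b - (k + 1 : ℕ)) (ht _ (by lia))
    rw [← hi] at this
    exact (hg.hasProjectiveDimensionLT_X₃_iff k (hK _)).2 this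

/-- Climb from C_{a-1} = 0, which is where boundedness below enters: B_i is a syzygy of C_i, and
C_{i+1} is an extension of B_i by H_{i+1}. -/
theorem hasProjectiveDimensionLT_opcycles_of_homology (K : ChainComplex C ℤ)
    (hK : ∀ i, Projective (K.X i)) {a : ℤ} (ha : ∀ i, i < a → IsZero (K.X i)) (n : ℕ)
    (h : ∀ i, HasProjectiveDimensionLT (K.homology i) (n + 1)) (i : ℤ) :
    HasProjectiveDimensionLT (K.opcycles i) (n + 1) := by
  by_cases hi : i < a
  · have h0 : IsZero (K.opcycles i) := (ha i hi).of_epi (K.pOpcycles i)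
    have := h0.hasProjectiveDimensionLT_zero
    exact hasProjectiveDimensionLT_of_ge _ 0 _ (Nat.zero_le _)
  · obtain ⟨k, rfl⟩ : ∃ k : ℕ, i = a - 1 + k := ⟨(i - (a - 1)).toNat, by lia⟩
    clear hi
    induction k with
    | zero =>
      have h0 : IsZero (K.opcycles (a - 1)) := (ha _ (by lia)).of_epi (K.pOpcycles _)
      have := h0.hasProjectiveDimensionLT_zero
      simpa using hasProjectiveDimensionLT_of_ge (K.opcycles (a - 1)) 0 (n + 1) (Nat.zero_le _)
    | succ k ih =>
      obtain ⟨B, f, g, wf, wg, hf, hg⟩ := exists_shortExact_opcycles K (a - 1 + k)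
      -- The bound is weakened by one so that passing to the syzygy B returns exactly the bound n;
      -- this also covers n = 0.
      have := hasProjectiveDimensionLT_of_ge (K.opcycles (a - 1 + k)) (n + 1) (n + 2) (by lia)
      have hB := (hg.hasProjectiveDimensionLT_X₃_iff n (hK _)).1 this
      rw [Nat.cast_succ, ← add_assoc]
      exact hf.hasProjectiveDimensionLT_X₂ _ (h _) hB

/-! ### Truncation -/

/-- The embedding of the shape `ℕ` into `ℤ` given by `k ↦ b - k`. -/
def embeddingLE (b : ℤ) : (ComplexShape.up ℕ).Embedding (ComplexShape.down ℤ) :=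
  ComplexShape.Embedding.mk' _ _ (fun k => b - k)
    (fun _ _ h => by simpa using h)
    (fun _ _ => by simp only [ComplexShape.up_Rel, ComplexShape.down_Rel]; lia)

theorem embeddingLE_f (b : ℤ) (k : ℕ) : (embeddingLE b).f k = b - k := rfl

instance (b : ℤ) : (embeddingLE b).IsRelIff where
  rel' _ _ h := by
    simp only [embeddingLE_f, ComplexShape.down_Rel] at h
    rw [ComplexShape.up_Rel]
    lia

instance (b : ℤ) : (embeddingLE b).IsTruncGE where
  mem_next {j _} h := ⟨j + 1, by
    simp only [embeddingLE_f, ComplexShape.down_Rel] at h ⊢; lia⟩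

theorem boundaryGE_embeddingLE_iff (b : ℤ) (k : ℕ) : (embeddingLE b).BoundaryGE k ↔ k = 0 := by
  constructor
  · rintro ⟨h, h'⟩
    by_contra hk
    obtain ⟨k, rfl⟩ := Nat.exists_eq_succ_of_ne_zero hk
    refine h' k ?_
    simp only [embeddingLE_f, ComplexShape.down_Rel]
    lia
  · rintro rfl
    refine (embeddingLE b).boundaryGE (i' := b + 1) (by simp [embeddingLE_f]) fun i => ?_
    simp only [embeddingLE_f]
    lia

/-- C_{t+d} is projective, so P may be cut off there with C_{t+d} as its last term. P need not be
bounded above, so this applies to infinite projective resolutions too. -/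
theorem qpd_le_of_hasProjectiveDimensionLT_opcycles {P : ChainComplex C ℤ} {M : C}
    (hM : ¬ IsZero M) (hP : IsQuasiProjectiveResolution P M) {t : ℤ}
    (ht : ∀ i, t < i → IsZero (P.homology i)) (ht' : ¬ IsZero (P.homology t)) (d : ℕ)
    (hd : HasProjectiveDimensionLT (P.opcycles t) (d + 1)) : qpd M ≤ d := by
  have hproj : Projective (P.opcycles (t + d)) := by
    have := hasProjectiveDimensionLT_opcycles_add P hP.projective ht 0 d (by simpa using hd)
    exact projective_iff_hasProjectiveDimensionLT_one.2 (by simpa using this)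
  -- The embedding reverses the order, so `truncGE` keeps the homological degrees ≤ t + d and puts
  -- the cokernel C_{t+d} in the boundary degree.
  let e := embeddingLE (t + d)
  let Q := P.truncGE e
  have hQX : ∀ i, i < t + d → Nonempty (Q.X i ≅ P.X i) := fun i hi =>
    ⟨P.truncGEXIso e (i := (t + d - i).toNat) (by simp only [e, embeddingLE_f]; lia)
      (by rw [boundaryGE_embeddingLE_iff]; lia)⟩
  have hQtop : Nonempty (Q.X (t + d) ≅ P.opcycles (t + d)) :=
    ⟨P.truncGEXIsoOpcycles e (i := 0) (by simp [e, embeddingLE_f])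
      (by rw [boundaryGE_embeddingLE_iff])⟩
  have hQ0 : ∀ i, t + d < i → IsZero (Q.X i) := fun i hi =>
    Q.isZero_X_of_isStrictlySupported e i fun k => by simp only [e, embeddingLE_f]; lia
  have hQH : ∀ i, Nonempty (Q.homology i ≅ P.homology i) := by
    intro i
    by_cases hi : t + d < i
    · have h0 : IsZero (Q.homology i) := (Q.sc i).exact_iff_isZero_homology.1
        (ShortComplex.exact_of_isZero_X₂ _ (hQ0 i hi))
      exact ⟨h0.iso (ht i (by lia))⟩
    · have : QuasiIsoAt (P.πTruncGE e) i := P.quasiIsoAt_πTruncGE e (j := (t + d - i).toNat)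
        (by simp only [e, embeddingLE_f]; lia)
      exact ⟨(isoOfQuasiIsoAt (P.πTruncGE e) i).symm⟩
  have hQ : IsFiniteQuasiProjectiveResolution Q M := by
    refine ⟨⟨?_, fun i => ?_, ?_⟩, ⟨t + d, hQ0⟩⟩
    · obtain ⟨a, ha⟩ := hP.boundedBelow
      exact ⟨min a (t + d), fun i hi => (ha i (by lia)).of_iso (hQX i (by lia)).some⟩
    · rcases lt_trichotomy i (t + d) with hi | rfl | hi
      · exact Projective.of_iso (hQX i hi).some.symm (hP.projective i)
      · exact Projective.of_iso hQtop.some.symm hproj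
      · have := (hQ0 i hi).hasProjectiveDimensionLT_zero
        exact projective_iff_hasProjectiveDimensionLT_one.2
          (hasProjectiveDimensionLT_of_ge _ 0 1 (by lia))
    · obtain ⟨n, hn, h⟩ := hP.homology
      exact ⟨n, hn, fun j => IsPower.of_iso (h j) (hQH j).some⟩
  exact qpd_le_of_resolution hM hQ hQ0 (t := t)
    (fun h => ht' (h.of_iso (hQH t).some.symm)) (by lia)

/-! ### Objects of finite projective dimension -/

/-- Descent on a finite bound for pd M: as long as it exceeds d, the homology at the top degree t
lowers it by one. It suffices to bound pd H_t, since M is a retract of H_t. -/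
theorem hasProjectiveDimensionLT_of_qpd_le {M : C} {n d : ℕ}
    (hn : HasProjectiveDimensionLT M (n + 1)) (hd : qpd M ≤ d) :
    HasProjectiveDimensionLT M (d + 1) := by
  by_cases hM : IsZero M
  · have := hM.hasProjectiveDimensionLT_zero
    exact hasProjectiveDimensionLT_of_ge _ 0 _ (Nat.zero_le _)
  obtain ⟨P, hP, hle⟩ := exists_resolution_of_qpd_le hM hd
  obtain ⟨a, ha⟩ := hP.boundedBelow
  obtain ⟨m, hm, hH⟩ := hP.homology
  set t := homologySup P with ht
  have htop := isGreatest_homologySup hM hP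
  rw [← ht] at htop
  have h0 : ∀ i, t < i → IsZero (P.homology i) := fun i hi => by
    by_contra h
    exact absurd (htop.2 h) (not_le.2 hi)
  have hpow : IsPower M (P.homology t) (m t) := hH t
  obtain ⟨r⟩ := hpow.retract fun h => htop.1 (hpow.isZero_iff.2 (.inl h))
  have hC : HasProjectiveDimensionLT (P.opcycles t) (d + 1) := by
    have := hasProjectiveDimensionLT_opcycles_sub P hP.projective (b := t + d) d
      (fun i hi => hP.isZero_X hM (by lia)) (fun i hi => h0 i (by lia))
    simpa using this
  induction n with
  | zero => exact hasProjectiveDimensionLT_of_ge _ 1 _ (by lia)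
  | succ n ih =>
    by_cases hnd : n + 1 ≤ d
    · exact hasProjectiveDimensionLT_of_ge _ (n + 1 + 1) _ (by lia)
    -- Now pd M ≤ n + 1 and d ≤ n. All C_i have projective dimension ≤ n + 1, hence so does B_{t-1},
    -- while pd C_t ≤ d ≤ n; the sequence 0 → H_t → C_t → B_{t-1} → 0 then gives pd H_t ≤ n.
    refine ih ?_
    have hop := hasProjectiveDimensionLT_opcycles_of_homology P hP.projective ha (n + 1)
      (fun i => IsPower.hasProjectiveDimensionLT (hH i) _ hn) (t - 1)
    obtain ⟨B, f, g, wf, wg, hf, hg⟩ := exists_shortExact_opcycles P (t - 1)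
    have := hasProjectiveDimensionLT_of_ge (P.opcycles (t - 1)) (n + 1 + 1) (n + 1 + 2) (by lia)
    have hB := (hg.hasProjectiveDimensionLT_X₃_iff (n + 1) (hP.projective _)).1 this
    have hC' := hasProjectiveDimensionLT_of_ge (P.opcycles t) (d + 1) (n + 1) (by lia)
    have hX₁ := hf.hasProjectiveDimensionLT_X₁ (n + 1) (by simpa using hC') hB
    have : HasProjectiveDimensionLT (P.homology t) (n + 1) := by simpa using hX₁
    exact r.hasProjectiveDimensionLT (n + 1)

/-- The embedding of the shape `ℕ` into `ℤ` for chain complexes. -/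
def embeddingNat : (ComplexShape.down ℕ).Embedding (ComplexShape.down ℤ) :=
  ComplexShape.Embedding.mk' _ _ (fun k => (k : ℤ)) (fun _ _ h => by simpa using h)
    (fun _ _ => by simp only [ComplexShape.down_Rel]; lia)

theorem embeddingNat_f (k : ℕ) : embeddingNat.f k = k := rfl

instance : embeddingNat.IsRelIff where
  rel' _ _ h := by
    simp only [embeddingNat_f, ComplexShape.down_Rel] at h
    rw [ComplexShape.down_Rel]
    lia

/-- A projective resolution, extended by zero to negative degrees, is quasi-projective with t = 0
and C_0 ≅ M; the truncation lemma makes it finite. -/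
theorem qpd_lt_top_of_hasProjectiveDimensionLT [EnoughProjectives C] {M : C} {n : ℕ}
    (hn : HasProjectiveDimensionLT M (n + 1)) : qpd M < ⊤ := by
  by_cases hM : IsZero M
  · simp [qpd_of_isZero hM]
  let R := projectiveResolution M
  let P : ChainComplex C ℤ := R.complex.extend embeddingNat
  have hX : ∀ i : ℤ, i < 0 → IsZero (P.X i) := fun i hi =>
    R.complex.isZero_extend_X embeddingNat i fun k => by rw [embeddingNat_f]; lia
  have hX' : ∀ k : ℕ, Nonempty (P.X k ≅ R.complex.X k) := fun k =>
    ⟨R.complex.extendXIso embeddingNat (i := k) rfl⟩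
  have hH : ∀ k : ℕ, Nonempty (P.homology k ≅ R.complex.homology k) := fun k =>
    ⟨R.complex.extendHomologyIso embeddingNat (j := k) rfl⟩
  have hzero : ∀ i, IsZero (P.X i) → IsZero (P.homology i) := fun i hi =>
    (P.sc i).exact_iff_isZero_homology.1 (ShortComplex.exact_of_isZero_X₂ _ hi)
  have hH0 : Nonempty (P.homology 0 ≅ M) :=
    ⟨(hH 0).some ≪≫ isoOfQuasiIsoAt R.π 0 ≪≫ HomologicalComplex.singleObjHomologySelfIso _ _ _⟩
  have hHi : ∀ i, i ≠ 0 → IsZero (P.homology i) := by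
    intro i hi
    rcases lt_or_gt_of_ne hi with hi | hi
    · exact hzero i (hX i hi)
    · obtain ⟨k, rfl⟩ : ∃ k : ℕ, i = (k + 1 : ℕ) := ⟨(i - 1).toNat, by lia⟩
      exact (R.complex_exactAt_succ k).isZero_homology.of_iso (hH _).some
  have hP : IsQuasiProjectiveResolution P M := by
    refine ⟨⟨0, hX⟩, fun i => ?_, fun i => if i = 0 then 1 else 0, ⟨0, by simp⟩, fun i => ?_⟩
    · by_cases hi : i < 0
      · have := (hX i hi).hasProjectiveDimensionLT_zero
        exact projective_iff_hasProjectiveDimensionLT_one.2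
          (hasProjectiveDimensionLT_of_ge _ 0 1 (by lia))
      · lift i to ℕ using by lia
        exact Projective.of_iso (hX' i).some.symm (R.projective i)
    · by_cases hi : i = 0
      · subst hi
        exact (IsPower.one M).of_iso hH0.some
      · change IsPower M _ (if i = 0 then 1 else 0)
        rw [if_neg hi]
        have h0 : IsPower M (⨁ fun _ : Fin 0 => M) 0 := ⟨Iso.refl _⟩
        exact h0.of_iso ((hHi i hi).iso (h0.isZero_iff.2 (.inl rfl)))
  -- The term in degree -1 vanishes, so H_0 is all of C_0.
  have : IsIso (P.homologyι 0) := P.isIso_homologyι 0 (-1)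
    ((ComplexShape.down ℤ).next_eq' (by simp))
    ((hX (-1) (by lia)).eq_of_tgt _ _)
  have := hasProjectiveDimensionLT_of_iso (hH0.some.symm ≪≫ asIso (P.homologyι 0)) (n + 1)
  exact (qpd_le_of_hasProjectiveDimensionLT_opcycles hM hP (t := 0) (fun i hi => hHi i hi.ne')
    (fun h => hM (h.of_iso hH0.some.symm)) n this).trans_lt (ENat.natCast_lt_top n)

end Abelian

section Abelian

attribute [local instance] Abelian.hasFiniteBiproducts

variable {C : Type w} [Category.{v} C] [Abelian C]

/-! ### Shifts and direct sums of resolutions -/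

/-- The translation `i ↦ i - k` of the shape `ℤ`. -/
def embeddingShift (k : ℤ) : (ComplexShape.down ℤ).Embedding (ComplexShape.down ℤ) :=
  ComplexShape.Embedding.mk' _ _ (fun i => i - k) (fun _ _ h => by simpa using h)
    (fun _ _ => by simp only [ComplexShape.down_Rel]; lia)

theorem embeddingShift_f (k i : ℤ) : (embeddingShift k).f i = i - k := rfl

instance (k : ℤ) : (embeddingShift k).IsRelIff where
  rel' _ _ h := by
    simp only [embeddingShift_f, ComplexShape.down_Rel] at h
    rw [ComplexShape.down_Rel]
    lia

/-- The complex `P` with the objects moved up by `k` degrees. -/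
def shiftUp (P : ChainComplex C ℤ) (k : ℤ) : ChainComplex C ℤ :=
  P.restriction (embeddingShift k)

/-- The homology of a shifted complex. -/
def shiftUpHomologyIso (P : ChainComplex C ℤ) (k i : ℤ) :
    (shiftUp P k).homology i ≅ P.homology (i - k) :=
  P.restrictionHomologyIso (embeddingShift k) (i + 1) i (i - 1)
    ((ComplexShape.down ℤ).prev_eq' rfl) ((ComplexShape.down ℤ).next_eq' (by simp))
    (i' := i + 1 - k) (j' := i - k) (k' := i - 1 - k) rfl rfl rfl
    ((ComplexShape.down ℤ).prev_eq' (by simp only [ComplexShape.down_Rel]; lia))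
    ((ComplexShape.down ℤ).next_eq' (by simp only [ComplexShape.down_Rel]; lia))

/-- The number of ways to choose one of the `m k` copies in degree `k` and one of the `n l` copies
in degree `l` with `k + l = j`. -/
def convolution (m n : ℤ → ℕ) (j : ℤ) : ℕ :=
  Nat.card (Σ p : (Σ k : ℤ, Fin (m k)), Fin (n (j - p.1)))

/-- The bijection exchanges k and j - k. -/
theorem convolution_comm (m n : ℤ → ℕ) (j : ℤ) : convolution m n j = convolution n m j := by
  have key : ∀ (m n : ℤ → ℕ) (x y : Σ p : (Σ k : ℤ, Fin (m k)), Fin (n (j - p.1))),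
      x.1.1 = y.1.1 → (x.1.2 : ℕ) = y.1.2 → (x.2 : ℕ) = y.2 → x = y := by
    rintro m n ⟨⟨k, a⟩, b⟩ ⟨⟨l, a'⟩, b'⟩ rfl h2 h3
    obtain rfl := Fin.ext h2
    obtain rfl := Fin.ext h3
    rfl
  exact Nat.card_congr ⟨fun x => ⟨⟨j - x.1.1, x.2⟩, x.1.2.cast (by simp)⟩,
    fun x => ⟨⟨j - x.1.1, x.2⟩, x.1.2.cast (by simp)⟩,
    fun x => key m n _ _ (by simp) (by simp) (by simp),
    fun x => key n m _ _ (by simp) (by simp) (by simp)⟩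

theorem finite_sigma_fin {m : ℤ → ℕ} {a b : ℤ} (ha : ∀ i, i < a → m i = 0)
    (hb : ∀ i, b < i → m i = 0) : Finite (Σ k : ℤ, Fin (m k)) := by
  refine Finite.of_injective (β := Σ k : Set.Icc a b, Fin (m k))
    (fun x => ⟨⟨x.1, ?_, ?_⟩, x.2⟩) ?_
  · by_contra! h
    exact (x.2.cast (ha _ h)).elim0
  · by_contra! h
    exact (x.2.cast (hb _ h)).elim0
  · rintro ⟨k, x⟩ ⟨l, y⟩ h
    simp only [Sigma.mk.injEq] at h
    exact Sigma.ext (congrArg Subtype.val h.1) h.2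

/-- The direct sum of shifts of `P`, with `m k` copies of the shift by `k`. -/
def sumShifts (P : ChainComplex C ℤ) (m : ℤ → ℕ) [Finite (Σ k : ℤ, Fin (m k))] :
    ChainComplex C ℤ :=
  ⨁ fun p : (Σ k : ℤ, Fin (m k)) => shiftUp P p.1

section

variable (P : ChainComplex C ℤ) (m : ℤ → ℕ) [Finite (Σ k : ℤ, Fin (m k))]

/-- The objects of a direct sum of shifts. -/
def sumShiftsXIso (i : ℤ) :
    (sumShifts P m).X i ≅ ⨁ fun p : (Σ k : ℤ, Fin (m k)) => P.X (i - p.1) :=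
  (HomologicalComplex.eval C (ComplexShape.down ℤ) i).mapBiproduct _

/-- The homology of a direct sum of shifts. -/
def sumShiftsHomologyIso (i : ℤ) :
    (sumShifts P m).homology i ≅ ⨁ fun p : (Σ k : ℤ, Fin (m k)) => P.homology (i - p.1) :=
  (HomologicalComplex.homologyFunctor C (ComplexShape.down ℤ) i).mapBiproduct _ ≪≫
    biproduct.mapIso fun p => shiftUpHomologyIso P p.1 i

theorem isZero_sumShifts_X {i : ℤ} (h : ∀ k, m k ≠ 0 → IsZero (P.X (i - k))) :
    IsZero ((sumShifts P m).X i) := by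
  refine IsZero.of_iso ?_ (sumShiftsXIso P m i)
  rw [IsZero.iff_id_eq_zero]
  refine biproduct.hom_ext' _ _ fun p => (h p.1 fun h0 => ?_).eq_of_src _ _
  exact (p.2.cast h0).elim0

theorem projective_sumShifts_X (hP : ∀ i, Projective (P.X i)) (i : ℤ) :
    Projective ((sumShifts P m).X i) := by
  refine Projective.of_iso (sumShiftsXIso P m i).symm ⟨fun f e _ => ?_⟩
  have := hP
  exact ⟨biproduct.desc fun p => Projective.factorThru
      (biproduct.ι (fun p : (Σ k : ℤ, Fin (m k)) => P.X (i - p.1)) p ≫ f) e,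
    biproduct.hom_ext' _ _ fun p => by simp⟩

theorem isPower_sumShifts_homology {M : C} {n : ℤ → ℕ}
    (h : ∀ j, IsPower M (P.homology j) (n j)) (j : ℤ) :
    IsPower M ((sumShifts P m).homology j) (convolution m n j) :=
  (IsPower.biproduct (J := Σ k : ℤ, Fin (m k)) fun p => h (j - p.1)).of_iso
    (sumShiftsHomologyIso P m j)

end

theorem convolution_ne_zero {m n : ℤ → ℕ} [Finite (Σ k : ℤ, Fin (m k))] {k l : ℤ}
    (hm : m k ≠ 0) (hn : n l ≠ 0) : convolution m n (k + l) ≠ 0 := by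
  have : Nonempty (Σ p : (Σ k : ℤ, Fin (m k)), Fin (n (k + l - p.1))) :=
    ⟨⟨⟨k, 0, Nat.pos_of_ne_zero hm⟩, 0, by simpa using Nat.pos_of_ne_zero hn⟩⟩
  -- Finiteness is essential here, as `Nat.card` of an infinite type is 0.
  exact Nat.card_pos.ne'

/-- Resolutions P of X and Q of Y have different multiplicities n and m. Summing shifts of P
according to m and shifts of Q according to n gives both the convolution of m and n, so the direct
sum resolves X ⊞ Y. -/
theorem qpd_biprod_le (X Y : C) : qpd (X ⊞ Y) ≤ max (qpd X) (qpd Y) := by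
  by_cases hX : IsZero X
  · have : qpd (X ⊞ Y) = qpd Y := qpd_eq_of_iso (isoZeroBiprod hX).symm
    simp [this]
  by_cases hY : IsZero Y
  · have : qpd (X ⊞ Y) = qpd X := qpd_eq_of_iso (isoBiprodZero hY).symm
    simp [this]
  have hXY : ¬ IsZero (X ⊞ Y) := fun h => hX (h.of_mono biprod.inl)
  obtain htop | hlt := eq_top_or_lt_top (max (qpd X) (qpd Y))
  · simp [htop]
  obtain ⟨d, hd⟩ := ENat.ne_top_iff_exists.1 hlt.ne
  rw [← hd]
  obtain ⟨P, hP, hPd⟩ := exists_resolution_of_qpd_le hX ((le_max_left _ _).trans hd.ge)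
  obtain ⟨Q, hQ, hQd⟩ := exists_resolution_of_qpd_le hY ((le_max_right _ _).trans hd.ge)
  obtain ⟨n, -, hn⟩ := hP.homology
  obtain ⟨m, -, hm⟩ := hQ.homology
  replace hn : ∀ j, IsPower X (P.homology j) (n j) := hn
  replace hm : ∀ j, IsPower Y (Q.homology j) (m j) := hm
  obtain ⟨a, ha⟩ := hP.boundedBelow
  obtain ⟨b, hb⟩ := hQ.boundedBelow
  have hPh := isGreatest_homologySup hX hP
  have hQh := isGreatest_homologySup hY hQ
  have hn0 : ∀ j, n j ≠ 0 ↔ ¬ IsZero (P.homology j) := fun j => by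
    rw [(hn j).isZero_iff]; tauto
  have hm0 : ∀ j, m j ≠ 0 ↔ ¬ IsZero (Q.homology j) := fun j => by
    rw [(hm j).isZero_iff]; tauto
  have hle : ∀ (K : ChainComplex C ℤ) (j : ℤ), IsZero (K.X j) → IsZero (K.homology j) :=
    fun K j hj => (K.sc j).exact_iff_isZero_homology.1 (ShortComplex.exact_of_isZero_X₂ _ hj)
  have hna : ∀ j, n j ≠ 0 → a ≤ j := fun j hj => by
    by_contra! h
    exact (hn0 j).1 hj (hle _ _ (ha j h))
  have hmb : ∀ j, m j ≠ 0 → b ≤ j := fun j hj => by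
    by_contra! h
    exact (hm0 j).1 hj (hle _ _ (hb j h))
  have hn1 : ∀ j, n j ≠ 0 → j ≤ homologySup P := fun j hj => hPh.2 ((hn0 j).1 hj)
  have hm1 : ∀ j, m j ≠ 0 → j ≤ homologySup Q := fun j hj => hQh.2 ((hm0 j).1 hj)
  have : Finite (Σ k : ℤ, Fin (n k)) := finite_sigma_fin (a := a) (b := homologySup P)
    (fun i hi => by_contra fun h => absurd (hna i h) (not_le.2 hi))
    (fun i hi => by_contra fun h => absurd (hn1 i h) (not_le.2 hi))
  have : Finite (Σ k : ℤ, Fin (m k)) := finite_sigma_fin (a := b) (b := homologySup Q)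
    (fun i hi => by_contra fun h => absurd (hmb i h) (not_le.2 hi))
    (fun i hi => by_contra fun h => absurd (hm1 i h) (not_le.2 hi))
  let T := sumShifts P m ⊞ sumShifts Q n
  have hTX : ∀ i, T.X i ≅ (sumShifts P m).X i ⊞ (sumShifts Q n).X i := fun i =>
    (HomologicalComplex.eval C (ComplexShape.down ℤ) i).mapBiprod _ _
  have (i : ℤ) : PreservesBinaryBiproducts
      (HomologicalComplex.homologyFunctor C (ComplexShape.down ℤ) i) :=
    preservesBinaryBiproducts_of_preservesBiproducts _
  have hTH : ∀ i, T.homology i ≅ (sumShifts P m).homology i ⊞ (sumShifts Q n).homology i :=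
    fun i => (HomologicalComplex.homologyFunctor C (ComplexShape.down ℤ) i).mapBiprod _ _
  have hTpow : ∀ j, IsPower (X ⊞ Y) (T.homology j) (convolution m n j) := fun j =>
    ((isPower_sumShifts_homology P m hn j).biprod
      (convolution_comm m n j ▸ isPower_sumShifts_homology Q n hm j)).of_iso (hTH j)
  have hT0 : ∀ i, IsZero ((sumShifts P m).X i) → IsZero ((sumShifts Q n).X i) → IsZero (T.X i) :=
    fun i h1 h2 => ((biprod_isZero_iff _ _).2 ⟨h1, h2⟩).of_iso (hTX i)
  have hne := convolution_ne_zero ((hm0 _).2 hQh.1) ((hn0 _).2 hPh.1)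
  -- The shifts of P are by at most hsup Q and those of Q by at most hsup P, so both summands end by
  -- hsup P + hsup Q + d, while hsup P + hsup Q carries nonzero homology.
  have hb' : ∀ i, homologySup P + homologySup Q + d < i → IsZero (T.X i) := fun i hi => by
    refine hT0 i (isZero_sumShifts_X P m fun k hk => hP.isZero_X hX ?_)
      (isZero_sumShifts_X Q n fun k hk => hQ.isZero_X hY ?_)
    · have := hm1 k hk
      lia
    · have := hn1 k hk
      lia
  refine qpd_le_of_resolution (P := T) hXY ⟨⟨⟨a + b, fun i hi => ?_⟩, fun i => ?_,
    convolution m n, ⟨_, hne⟩, hTpow⟩, ⟨_, hb'⟩⟩ hb' (t := homologySup Q + homologySup P) ?_ ?_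
  · refine hT0 i (isZero_sumShifts_X P m fun k hk => ha _ ?_)
      (isZero_sumShifts_X Q n fun k hk => hb _ ?_)
    · have := hmb k hk
      lia
    · have := hna k hk
      lia
  · have := projective_sumShifts_X P m hP.projective i
    have := projective_sumShifts_X Q n hQ.projective i
    exact Projective.of_iso (hTX i).symm inferInstance
  · rw [(hTpow _).isZero_iff]
    tauto
  · lia

end Abelian

/-! ### Finite generation up to projective summands -/

section StablyFinite

variable (R : Type u) [Ring R]

/-- A module which becomes finitely generated up to projective direct summands. -/
def StablyFinite (M : Type u) [AddCommGroup M] [Module R M] : Prop :=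
  ∃ E Q Q' : ModuleCat.{u} R, Module.Finite R E ∧ Module.Projective R Q ∧
    Module.Projective R Q' ∧ Nonempty ((M × Q) ≃ₗ[R] (E × Q'))

variable {R} {M N H X : Type u} [AddCommGroup M] [Module R M] [AddCommGroup N] [Module R N]
  [AddCommGroup H] [Module R H] [AddCommGroup X] [Module R X]

theorem nonempty_equiv_ker_prod [Module.Projective R N] (f : M →ₗ[R] N)
    (hf : Function.Surjective f) : Nonempty (M ≃ₗ[R] (LinearMap.ker f × N)) := by
  obtain ⟨s, hs⟩ := f.exists_rightInverse_of_surjective (LinearMap.range_eq_top.2 hf)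
  exact ⟨(Function.Exact.splitSurjectiveEquiv (f := (LinearMap.ker f).subtype) (g := f)
    (LinearMap.exact_subtype_ker_map f) (Submodule.injective_subtype _) ⟨s, hs⟩).1⟩

/-- Schanuel's lemma. -/
theorem nonempty_equiv_of_surjective [Module.Projective R X] [Module.Projective R N]
    (f : X →ₗ[R] M) (g : N →ₗ[R] M) (hf : Function.Surjective f) (hg : Function.Surjective g) :
    Nonempty ((LinearMap.ker f × N) ≃ₗ[R] (LinearMap.ker g × X)) := by
  -- W is the pullback of f and g. Its projections to X and N are surjections onto projectives,
  -- hence split, with kernels ker g and ker f.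
  let W := LinearMap.eqLocus (f ∘ₗ LinearMap.fst R X N) (g ∘ₗ LinearMap.snd R X N)
  let p : W →ₗ[R] X := LinearMap.fst R X N ∘ₗ W.subtype
  let q : W →ₗ[R] N := LinearMap.snd R X N ∘ₗ W.subtype
  have hW : ∀ w : W, f (p w) = g (q w) := fun w => w.2
  have hp : Function.Surjective p := fun x => by
    obtain ⟨y, hy⟩ := hg (f x)
    exact ⟨⟨(x, y), hy.symm⟩, rfl⟩
  have hq : Function.Surjective q := fun y => by
    obtain ⟨x, hx⟩ := hf (g y)
    exact ⟨⟨(x, y), hx⟩, rfl⟩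
  have ep : LinearMap.ker p ≃ₗ[R] LinearMap.ker g :=
    LinearEquiv.ofBijective ((q ∘ₗ (LinearMap.ker p).subtype).codRestrict _ fun w => by
        have h1 : p w = 0 := w.2
        have h2 := hW w
        rw [h1, map_zero] at h2
        exact h2.symm)
      ⟨fun w w' h => Subtype.ext (Subtype.ext (Prod.ext
          ((show p w = 0 from w.2).trans (show p w' = 0 from w'.2).symm)
          (congrArg Subtype.val h))),
        fun y => ⟨⟨⟨(0, y), (map_zero f).trans (show g y = 0 from y.2).symm⟩, rfl⟩, rfl⟩⟩
  have eq : LinearMap.ker q ≃ₗ[R] LinearMap.ker f :=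
    LinearEquiv.ofBijective ((p ∘ₗ (LinearMap.ker q).subtype).codRestrict _ fun w => by
        have h1 : q w = 0 := w.2
        have h2 := hW w
        rw [h1, map_zero] at h2
        exact h2)
      ⟨fun w w' h => Subtype.ext (Subtype.ext (Prod.ext
          (congrArg Subtype.val h)
          ((show q w = 0 from w.2).trans (show q w' = 0 from w'.2).symm))),
        fun y => ⟨⟨⟨(y, 0), (show f y = 0 from y.2).trans (map_zero g).symm⟩, rfl⟩, rfl⟩⟩
  obtain ⟨e1⟩ := nonempty_equiv_ker_prod p hp
  obtain ⟨e2⟩ := nonempty_equiv_ker_prod q hq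
  exact ⟨(eq.symm.prodCongr (.refl R N)) ≪≫ₗ e2.symm ≪≫ₗ e1 ≪≫ₗ (ep.prodCongr (.refl R X))⟩

theorem StablyFinite.of_finite [Module.Finite R M] : StablyFinite R M :=
  ⟨ModuleCat.of R M, ModuleCat.of R PUnit.{u + 1}, ModuleCat.of R PUnit.{u + 1}, ‹_›,
    inferInstanceAs (Module.Projective R PUnit.{u + 1}), inferInstanceAs (Module.Projective R PUnit.{u + 1}),
    ⟨LinearEquiv.refl R _⟩⟩

variable [IsNoetherianRing R]

/-- Apply Schanuel's lemma to X × Q and R^n × Q', both mapping onto E × Q'. The first kernel is H;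
the second embeds in R^n and is finitely generated because R is Noetherian. -/
theorem StablyFinite.syzygy (hM : StablyFinite R M) [Module.Projective R X] (i : H →ₗ[R] X)
    (f : X →ₗ[R] M) (hi : Function.Injective i) (hif : Function.Exact i f)
    (hf : Function.Surjective f) : StablyFinite R H := by
  obtain ⟨E, Q, Q', hE, hQ, hQ', ⟨e⟩⟩ := hM
  obtain ⟨n, g, hg⟩ := Module.Finite.exists_fin' R E
  let f' : (X × Q) →ₗ[R] (E × Q') := e.toLinearMap ∘ₗ (f.prodMap LinearMap.id)
  let g' : ((Fin n → R) × Q') →ₗ[R] (E × Q') := g.prodMap LinearMap.id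
  obtain ⟨s⟩ := nonempty_equiv_of_surjective f' g'
    (e.surjective.comp (hf.prodMap Function.surjective_id)) (hg.prodMap Function.surjective_id)
  have h1 : H ≃ₗ[R] LinearMap.ker f' :=
    LinearEquiv.ofBijective ((LinearMap.inl R X Q ∘ₗ i).codRestrict _ fun x => by
        simp [f', hif.apply_apply_eq_zero x])
      ⟨fun x y h => hi (congrArg (fun z => z.1.1) h), fun z => by
        have hz : f' z = 0 := z.2
        have hz' : (f z.1.1, z.1.2) = (0 : M × Q) := e.injective (hz.trans (map_zero e).symm)
        obtain ⟨x, hx⟩ := (hif z.1.1).1 (congrArg Prod.fst hz')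
        exact ⟨x, Subtype.ext (Prod.ext hx (congrArg Prod.snd hz').symm)⟩⟩
  have : Module.Finite R (LinearMap.ker g') := by
    refine Module.Finite.of_injective (M := LinearMap.ker g') (N := Fin n → R)
      (LinearMap.fst R _ _ ∘ₗ (LinearMap.ker g').subtype) fun x y h => ?_
    have hx : g' x = 0 := x.2
    have hy : g' y = 0 := y.2
    exact Subtype.ext (Prod.ext h ((congrArg Prod.snd hx).trans (congrArg Prod.snd hy).symm))
  exact ⟨ModuleCat.of R (LinearMap.ker g'), ModuleCat.of R ((Fin n → R) × Q'),
    ModuleCat.of R (X × Q), this, inferInstanceAs (Module.Projective R ((Fin n → R) × Q')),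
    inferInstanceAs (Module.Projective R (X × Q)), ⟨(h1.prodCongr (.refl R _)) ≪≫ₗ s⟩⟩

/-- Splitting off Q' from M × Q leaves the kernel of M × Q → Q', an extension of E by the image of
H, which is finitely generated. -/
theorem StablyFinite.extension (hN : StablyFinite R N) [Module.Finite R H] (i : H →ₗ[R] M)
    (f : M →ₗ[R] N) (hif : Function.Exact i f) (hf : Function.Surjective f) :
    StablyFinite R M := by
  obtain ⟨E, Q, Q', hE, hQ, hQ', ⟨e⟩⟩ := hN
  let φ : (M × Q) →ₗ[R] (E × Q') := e.toLinearMap ∘ₗ (f.prodMap LinearMap.id)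
  have hφ : Function.Surjective φ := e.surjective.comp (hf.prodMap Function.surjective_id)
  let q : (M × Q) →ₗ[R] Q' := LinearMap.snd R E Q' ∘ₗ φ
  obtain ⟨s⟩ := nonempty_equiv_ker_prod q (Prod.snd_surjective.comp hφ)
  let j : H →ₗ[R] LinearMap.ker q := (LinearMap.inl R M Q ∘ₗ i).codRestrict _ fun x => by
    simp [q, φ, hif.apply_apply_eq_zero x, Prod.mk_zero_zero]
  let p : LinearMap.ker q →ₗ[R] E := LinearMap.fst R E Q' ∘ₗ φ ∘ₗ (LinearMap.ker q).subtype
  have hjp : LinearMap.range j = LinearMap.ker p := by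
    ext z
    constructor
    · rintro ⟨x, rfl⟩
      change (φ (i x, 0)).1 = 0
      simp [φ, hif.apply_apply_eq_zero x, Prod.mk_zero_zero]
    · intro hz
      have h1 : φ z = 0 := Prod.ext hz z.2
      have h2 : (f z.1.1, z.1.2) = (0 : N × Q) := e.injective (h1.trans (map_zero e).symm)
      obtain ⟨x, hx⟩ := (hif z.1.1).1 (congrArg Prod.fst h2)
      exact ⟨x, Subtype.ext (Prod.ext hx (congrArg Prod.snd h2).symm)⟩
  have := isNoetherian_of_range_eq_ker j p hjp
  exact ⟨ModuleCat.of R (LinearMap.ker q), Q, Q',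
    inferInstanceAs (Module.Finite R (LinearMap.ker q)), hQ, hQ', ⟨s⟩⟩

end StablyFinite

/-! ### The finitistic dimension -/

section Rings

variable {R : Type u} [Ring R]

theorem pd_le_iff (M : ModuleCat.{u} R) (n : ℕ) :
    pd R M ≤ n ↔ HasProjectiveDimensionLT M (n + 1) := by
  rw [← HasProjectiveDimensionLE, ← projectiveDimension_le_iff, pd]
  generalize projectiveDimension M = x
  induction x using WithBot.recBotCoe with
  | bot => simp
  | coe x => exact WithBot.coe_le_coe.symm

theorem HasProjectiveDimensionLT.biprod_iff {C : Type*} [Category* C] [Abelian C] {X Q : C}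
    [Projective Q] {n : ℕ} :
    HasProjectiveDimensionLT (X ⊞ Q) (n + 1) ↔ HasProjectiveDimensionLT X (n + 1) := by
  constructor
  · intro h
    exact (Retract.mk (biprod.inl : X ⟶ X ⊞ Q) biprod.fst).hasProjectiveDimensionLT _
  · intro h
    have := hasProjectiveDimensionLT_of_ge Q 1 (n + 1) (by lia)
    infer_instance

/-- Projective summands do not affect these bounds, so M may be replaced by the finitely generated
module E, which is one of the modules counted by `fdim`. -/
theorem StablyFinite.hasProjectiveDimensionLT {M : ModuleCat.{u} R} (h : StablyFinite R M) {f : ℕ}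
    (hf : fdim R ≤ f) {d : ℕ} (hd : HasProjectiveDimensionLT M (d + 1)) :
    HasProjectiveDimensionLT M (f + 1) := by
  obtain ⟨E, Q, Q', hE, hQ, hQ', ⟨e⟩⟩ := h
  have e' : M ⊞ Q ≅ E ⊞ Q' :=
    ModuleCat.biprodIsoProd M Q ≪≫ e.toModuleIso ≪≫ (ModuleCat.biprodIsoProd E Q').symm
  have := (IsProjective.iff_projective Q).1 hQ
  have := (IsProjective.iff_projective Q').1 hQ'
  have key : ∀ n : ℕ, HasProjectiveDimensionLT M (n + 1) ↔ HasProjectiveDimensionLT E (n + 1) := by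
    intro n
    rw [← HasProjectiveDimensionLT.biprod_iff (Q := Q),
      ← HasProjectiveDimensionLT.biprod_iff (X := E) (Q := Q')]
    exact ⟨fun h => hasProjectiveDimensionLT_of_iso e' _,
      fun h => hasProjectiveDimensionLT_of_iso e'.symm _⟩
  rw [key] at hd ⊢
  rw [← pd_le_iff] at hd ⊢
  refine le_trans ?_ hf
  exact le_iSup₂_of_le E hE (le_iSup_of_le (hd.trans_lt (ENat.natCast_lt_top d)) le_rfl)

theorem IsPower.finite {M N : ModuleCat.{u} R} {n : ℕ} (h : IsPower M N n)
    (hM : Module.Finite R M) : Module.Finite R N := by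
  have e : N ≅ ModuleCat.of R (Fin n → M) := h.some ≪≫ ModuleCat.biproductIsoPi _
  have : Module.Finite R (Fin n → M) := inferInstance
  exact Module.Finite.equiv e.toLinearEquiv.symm

theorem pd_le_qpd (M : ModuleCat.{u} R) (h : pd R M < ⊤) : qpd M < ⊤ ∧ pd R M ≤ qpd M := by
  obtain ⟨n, hn⟩ := ENat.ne_top_iff_exists.1 h.ne
  have hn' := (pd_le_iff M n).1 hn.ge
  have hq := qpd_lt_top_of_hasProjectiveDimensionLT hn'
  refine ⟨hq, ?_⟩
  obtain ⟨d, hd⟩ := ENat.ne_top_iff_exists.1 hq.ne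
  rw [← hd, pd_le_iff]
  exact hasProjectiveDimensionLT_of_qpd_le hn' hd.ge

variable [IsNoetherianRing R]

/-- The terms of K need not be finitely generated, so neither need C_i. The property survives both
the syzygy and the extension when climbing from C_{a-1} = 0. -/
theorem stablyFinite_opcycles (K : ChainComplex (ModuleCat.{u} R) ℤ)
    (hK : ∀ i, Projective (K.X i)) {a : ℤ} (ha : ∀ i, i < a → IsZero (K.X i))
    (h : ∀ i, Module.Finite R (K.homology i)) (i : ℤ) : StablyFinite R (K.opcycles i) := by
  have h0 : ∀ i, i < a → StablyFinite R (K.opcycles i) := fun i hi => by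
    have h0 : IsZero (K.opcycles i) := (ha i hi).of_epi (K.pOpcycles i)
    have := ModuleCat.subsingleton_of_isZero h0
    exact StablyFinite.of_finite
  by_cases hi : i < a
  · exact h0 i hi
  · obtain ⟨k, rfl⟩ : ∃ k : ℕ, i = a - 1 + k := ⟨(i - (a - 1)).toNat, by lia⟩
    clear hi
    induction k with
    | zero => exact h0 _ (by simp)
    | succ k ih =>
      obtain ⟨B, f, g, wf, wg, hf, hg⟩ := exists_shortExact_opcycles K (a - 1 + k)
      have hp : Module.Projective R (K.X (a - 1 + k)) :=
        (IsProjective.iff_projective _).2 (hK _)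
      have hB : StablyFinite R B := ih.syzygy g.hom (K.pOpcycles (a - 1 + k)).hom
        hg.moduleCat_injective_f
        ((ShortComplex.ShortExact.moduleCat_exact_iff_function_exact _).1 hg.exact)
        hg.moduleCat_surjective_g
      rw [Nat.cast_succ, ← add_assoc]
      have := h (a - 1 + k + 1)
      exact hB.extension (K.homologyι (a - 1 + k + 1)).hom f.hom
        ((ShortComplex.ShortExact.moduleCat_exact_iff_function_exact _).1 hf.exact)
        hf.moduleCat_surjective_g

/-- A given finite resolution only serves to show that pd C_t is finite; `fdim` then bounds it, and
truncation turns the bound into a new resolution. -/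
theorem qpd_le_fdim (M : ModuleCat.{u} R) (hM : Module.Finite R M) (h : qpd M < ⊤) :
    qpd M ≤ fdim R := by
  obtain htop | hlt := eq_top_or_lt_top (fdim R)
  · simp [htop]
  by_cases hz : IsZero M
  · simp [qpd_of_isZero hz]
  obtain ⟨f, hf⟩ := ENat.ne_top_iff_exists.1 hlt.ne
  obtain ⟨d, hd⟩ := ENat.ne_top_iff_exists.1 h.ne
  obtain ⟨P, hP, hle⟩ := exists_resolution_of_qpd_le hz hd.ge
  have htop := isGreatest_homologySup hz hP
  obtain ⟨a, ha⟩ := hP.boundedBelow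
  obtain ⟨n, -, hn⟩ := hP.homology
  have h0 : ∀ i, homologySup P < i → IsZero (P.homology i) := fun i hi => by
    by_contra h
    exact absurd (htop.2 h) (not_le.2 hi)
  rw [← hf]
  refine qpd_le_of_hasProjectiveDimensionLT_opcycles hz hP.toIsQuasiProjectiveResolution h0
    htop.1 f ?_
  have hC := hasProjectiveDimensionLT_opcycles_sub P hP.projective (b := homologySup P + d) d
    (fun i hi => hP.isZero_X hz (by lia)) (fun i hi => h0 i (by lia))
  rw [add_sub_cancel_right] at hC
  exact StablyFinite.hasProjectiveDimensionLT (stablyFinite_opcycles P hP.projective ha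
    (fun i => IsPower.finite (hn i) hM) _) hf.ge hC

variable (R)

theorem fdim_eq : fdim R =
    ⨆ (M : ModuleCat.{u} R) (_ : Module.Finite R M) (_ : qpd M < ⊤), qpd M := by
  refine le_antisymm (iSup₂_le fun M hM => iSup_le fun h => ?_)
    (iSup₂_le fun M hM => iSup_le fun h => qpd_le_fdim M hM h)
  obtain ⟨h1, h2⟩ := pd_le_qpd M h
  exact h2.trans (le_iSup₂_of_le M hM (le_iSup_of_le h1 le_rfl))

theorem fdim_eq_qgldim (h : qgldim R < ⊤) : fdim R = qgldim R := by
  rw [fdim_eq, qgldim]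
  refine iSup_congr fun M => iSup_congr fun hM => ?_
  have : qpd M < ⊤ := lt_of_le_of_lt (le_iSup₂_of_le M hM le_rfl) h
  simp [this]

end Rings

/-! ### Comparison of quasi-global dimensions along functors -/

section ChangeOfRings

open ModuleCat

attribute [local instance] Abelian.hasFiniteBiproducts

variable {A B : Type u} [Ring A] [Ring B]

theorem qgldim_le_of_functor (F : ModuleCat.{u} A ⥤ ModuleCat.{u} B) [F.Additive]
    [F.PreservesHomology] (hF : ∀ P, Projective P → Projective (F.obj P))
    (h : ∀ N : ModuleCat.{u} B, Module.Finite B N → ∃ (M : ModuleCat.{u} A) (d : ℕ),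
      Module.Finite A M ∧ d ≠ 0 ∧ IsPower N (F.obj M) d) : qgldim B ≤ qgldim A := by
  refine iSup₂_le fun N hN => ?_
  obtain ⟨M, d, hM, hd, hp⟩ := h N hN
  exact (qpd_le_qpd_of_isPower hp hd).trans ((qpd_map_le F hF M).trans
    (le_iSup₂_of_le M hM le_rfl))

/-! ### Morita equivalence -/

/-- Being Noetherian depends only on the lattice of submodules, that is of subobjects, and an
equivalence preserves that lattice. -/
theorem finite_map_of_equivalence [IsNoetherianRing A] (e : ModuleCat.{u} A ≌ ModuleCat.{u} B)
    (M : ModuleCat.{u} A) (hM : Module.Finite A M) : Module.Finite B (e.functor.obj M) := by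
  have h : IsNoetherian A M := inferInstance
  have o : Submodule A M ≃o Submodule B (e.functor.obj M) :=
    (subobjectModule M).symm.trans
      ((((ThinSkeleton.equivalence _).trans (MonoOver.congr M e)).trans
        (ThinSkeleton.equivalence _).symm).toOrderIso.trans (subobjectModule _))
  have : IsNoetherian B (e.functor.obj M) := by
    rw [isNoetherian_iff'] at h ⊢
    exact o.symm.toOrderEmbedding.wellFoundedGT
  infer_instance

theorem qgldim_le_of_equivalence [IsNoetherianRing B] (e : ModuleCat.{u} A ≌ ModuleCat.{u} B)
    [e.functor.Additive] : qgldim B ≤ qgldim A :=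
  qgldim_le_of_functor e.functor (fun P hP => (e.map_projective_iff P).2 hP) fun N hN =>
    ⟨e.inverse.obj N, 1, finite_map_of_equivalence e.symm N hN, one_ne_zero,
      (IsPower.one N).of_iso (e.counitIso.app N)⟩

/-! ### Restriction of scalars -/

variable (f : A →+* B)

instance preservesHomology_restrictScalars :
    (restrictScalars.{u} f).PreservesHomology :=
  Functor.preservesHomology_of_map_exact _ fun _ hS => by
    rw [ShortComplex.ShortExact.moduleCat_exact_iff_function_exact] at hS ⊢
    exact hS

/-- Coextension is Hom_A(B, -), and B is projective over A. -/
theorem epi_coextendScalars [Module.Projective A ((restrictScalars f).obj (of B B))] :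
    (coextendScalars.{u, u, u} f).PreservesEpimorphisms where
  preserves {M N} g hg := by
    rw [ModuleCat.epi_iff_surjective] at hg ⊢
    intro h
    obtain ⟨k, hk⟩ := Module.projective_lifting_property g.hom
      (CoextendScalars.equiv f N h) hg
    exact ⟨(CoextendScalars.equiv f M).symm k, CoextendScalars.ext hk⟩

/-- Restriction is left adjoint to coextension, and a left adjoint of a functor preserving
epimorphisms preserves projectives. -/
theorem projective_restrictScalars [Module.Projective A ((restrictScalars f).obj (of B B))]
    (P : ModuleCat.{u} B) (hP : Projective P) : Projective ((restrictScalars.{u} f).obj P) :=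
  have := epi_coextendScalars f
  (restrictCoextendScalarsAdj f).map_projective P hP

theorem finite_of_smul_eq {M : Type u} [AddCommGroup M] [Module A M] [Module B M]
    (h : ∀ (a : A) (m : M), f a • m = a • m) (hM : Module.Finite A M) : Module.Finite B M := by
  obtain ⟨s, hs⟩ := hM.fg_top
  refine ⟨⟨s, eq_top_iff.2 fun x _ => ?_⟩⟩
  have hx : x ∈ Submodule.span A (s : Set M) := hs ▸ Submodule.mem_top
  induction hx using Submodule.span_induction with
  | mem x h => exact Submodule.subset_span h
  | zero => exact Submodule.zero_mem _
  | add x y _ _ hx hy => exact Submodule.add_mem _ (hx trivial) (hy trivial)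
  | smul a x _ hx => exact h a x ▸ Submodule.smul_mem _ (f a) (hx trivial)

theorem finite_of_smul_eq_of_surjective {M : Type u} [AddCommGroup M] [Module A M] [Module B M]
    (h : ∀ (a : A) (m : M), f a • m = a • m) (hf : Function.Surjective f)
    (hM : Module.Finite B M) : Module.Finite A M := by
  obtain ⟨s, hs⟩ := hM.fg_top
  refine ⟨⟨s, eq_top_iff.2 fun x _ => ?_⟩⟩
  have hx : x ∈ Submodule.span B (s : Set M) := hs ▸ Submodule.mem_top
  induction hx using Submodule.span_induction with
  | mem x h => exact Submodule.subset_span h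
  | zero => exact Submodule.zero_mem _
  | add x y _ _ hx hy => exact Submodule.add_mem _ (hx trivial) (hy trivial)
  | smul b x _ hx =>
    obtain ⟨a, rfl⟩ := hf b
    exact h a x ▸ Submodule.smul_mem _ a (hx trivial)

theorem finite_restrictScalars (hf : Function.Surjective f) (M : ModuleCat.{u} B)
    (hM : Module.Finite B M) : Module.Finite A ((restrictScalars f).obj M) :=
  letI : Module A M := Module.compHom M f
  finite_of_smul_eq_of_surjective f (M := M) (fun _ _ => rfl) hf hM

theorem finite_of_restrictScalars (M : ModuleCat.{u} B)
    (hM : Module.Finite A ((restrictScalars f).obj M)) : Module.Finite B M :=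
  letI : Module A M := Module.compHom M f
  finite_of_smul_eq f (M := M) (fun _ _ => rfl) hM

theorem qgldim_le_of_ringEquiv (e : A ≃+* B) : qgldim A ≤ qgldim B := by
  let E := restrictScalarsEquivalenceOfRingEquiv.{u} e
  have : E.functor.Additive := inferInstance
  refine qgldim_le_of_functor E.functor (fun P hP => (E.map_projective_iff P).2 hP) fun N hN =>
    ⟨E.inverse.obj N, 1, ?_, one_ne_zero, (IsPower.one N).of_iso (E.counitIso.app N)⟩
  exact finite_restrictScalars e.symm.toRingHom e.symm.surjective N hN

end ChangeOfRings

/-! ### Direct factors and products of rings -/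

section DirectFactor

open ModuleCat

attribute [local instance] Abelian.hasFiniteBiproducts

variable {A B : Type u} [Ring A] [Ring B]

/-- The ring `B` is a direct factor of `A`, with projection `f` and (non-unital) inclusion `i`. -/
structure IsDirectFactor (f : A →+* B) (i : B →ₙ+* A) : Prop where
  proj_incl : ∀ b, f (i b) = b
  incl_proj : ∀ a, i (f a) = i 1 * a
  incl_proj' : ∀ a, i (f a) = a * i 1

namespace IsDirectFactor

variable {f : A →+* B} {i : B →ₙ+* A} (h : IsDirectFactor f i)
include h

theorem incl_mul (a : A) (b : B) : i (f a * b) = a * i b := by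
  rw [map_mul, h.incl_proj', mul_assoc, ← map_mul, one_mul]

theorem mul_incl (a : A) (b : B) : i (b * f a) = i b * a := by
  rw [map_mul, h.incl_proj, ← mul_assoc, ← map_mul, mul_one]

theorem projective : Module.Projective A ((restrictScalars f).obj (of B B)) := by
  let s : (restrictScalars f).obj (of B B) →ₗ[A] A :=
    { toFun := fun b => i b
      map_add' := fun b c => map_add i b c
      map_smul' := fun a b => h.incl_mul a b }
  let p : A →ₗ[A] (restrictScalars f).obj (of B B) :=
    { toFun := fun a => f a
      map_add' := fun a c => map_add f a c
      map_smul' := fun a c => map_mul f a c }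
  exact Module.Projective.of_split s p (LinearMap.ext fun b => h.proj_incl b)

theorem surjective : Function.Surjective f := fun b => ⟨i b, h.proj_incl b⟩

theorem full : (restrictScalars.{u} f).Full where
  map_surjective {M N} g := by
    refine ⟨ModuleCat.ofHom
      { toFun := fun m => g.hom m, map_add' := fun x y => map_add g.hom x y,
        map_smul' := fun b m => ?_ }, ?_⟩
    · obtain ⟨a, rfl⟩ := h.surjective b
      exact g.hom.map_smul a (show (restrictScalars f).obj M from m)
    · rfl

omit h in
theorem additive_coextendScalars (f : A →+* B) : (coextendScalars.{u, u, u} f).Additive :=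
  (restrictCoextendScalarsAdj f).right_adjoint_additive

/-- As a right adjoint coextension preserves kernels, and it preserves epimorphisms since B is
projective over A. -/
theorem preservesHomology_coextendScalars :
    have := additive_coextendScalars f
    (coextendScalars.{u, u, u} f).PreservesHomology := by
  have := additive_coextendScalars f
  have := h.projective
  have := epi_coextendScalars f
  have : PreservesLimitsOfSize.{0, 0} (coextendScalars.{u, u, u} f) :=
    (restrictCoextendScalarsAdj.{u, u, u} f).rightAdjoint_preservesLimits
  exact Functor.preservesHomology_of_preservesEpis_and_kernels _

omit h in
/-- Evaluation at `1`. -/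
def counitLinearMap (f : A →+* B) (M : ModuleCat.{u} A) :
    (restrictScalars f).obj ((coextendScalars f).obj M) →ₗ[A] M where
  toFun g := CoextendScalars.equiv f M g (1 : B)
  map_add' _ _ := rfl
  map_smul' a g := by
    let x : (restrictScalars f).obj (of B B) := (1 : B)
    refine Eq.trans ?_ ((CoextendScalars.equiv f M g).map_smul a x)
    change CoextendScalars.equiv f M g (1 * f a : B) = CoextendScalars.equiv f M g (f a * 1 : B)
    rw [one_mul, mul_one]

/-- The map `m ↦ (b ↦ b • m)`, right inverse to the counit. -/
def sectionLinearMap (M : ModuleCat.{u} A) :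
    M →ₗ[A] (restrictScalars f).obj ((coextendScalars f).obj M) where
  toFun m := (CoextendScalars.equiv f M).symm
    { toFun := fun b : B => i b • m
      map_add' := fun (b c : B) => show i (b + c) • m = i b • m + i c • m by
        rw [map_add, add_smul]
      map_smul' := fun a (b : B) => show i (f a * b) • m = a • i b • m by
        rw [h.incl_mul, mul_smul] }
  map_add' m n := CoextendScalars.ext (LinearMap.ext fun b => smul_add _ _ _)
  map_smul' a m := CoextendScalars.ext (LinearMap.ext fun (b : B) =>
    show i b • a • m = i (b * f a) • m by rw [h.mul_incl, mul_smul])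

theorem sectionLinearMap_comp_counitLinearMap (M : ModuleCat.{u} A) :
    sectionLinearMap h M ∘ₗ counitLinearMap f M = LinearMap.id := by
  refine LinearMap.ext fun g => CoextendScalars.ext (LinearMap.ext fun b => ?_)
  change i b • CoextendScalars.equiv f M g (1 : B) = CoextendScalars.equiv f M g b
  let x : (restrictScalars f).obj (of B B) := (1 : B)
  refine ((CoextendScalars.equiv f M g).map_smul (i b) x).symm.trans ?_
  exact congrArg (CoextendScalars.equiv f M g) ((mul_one (f (i b))).trans (h.proj_incl b))

/-- Restriction is fully faithful and left adjoint to coextension, so it reflects projectives.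
Restricting the coextension of P gives a retract of P, namely its part i(1)P. -/
theorem projective_coextendScalars (P : ModuleCat.{u} A) (hP : Projective P) :
    Projective ((coextendScalars f).obj P) := by
  have := h.full
  refine (restrictCoextendScalarsAdj.{u, u, u} f).projective_of_map_projective _ ?_
  have r : Retract (of A ((restrictScalars f).obj ((coextendScalars f).obj P))) P :=
    { i := ModuleCat.ofHom (counitLinearMap f P)
      r := ModuleCat.ofHom (sectionLinearMap h P)
      retract := by
        rw [← ModuleCat.ofHom_comp, h.sectionLinearMap_comp_counitLinearMap]
        rfl }
  exact r.projective

theorem finite_coextendScalars (M : ModuleCat.{u} A) (hM : Module.Finite A M) :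
    Module.Finite B ((coextendScalars f).obj M) := by
  refine finite_of_restrictScalars f _ ?_
  refine Module.Finite.of_surjective (sectionLinearMap h M) fun g => ⟨counitLinearMap f M g, ?_⟩
  exact LinearMap.congr_fun (h.sectionLinearMap_comp_counitLinearMap M) g

/-- Since restriction is fully faithful, the unit is an isomorphism, so every B-module N is the
coextension of its restriction to A. -/
theorem qgldim_le : qgldim B ≤ qgldim A := by
  have := additive_coextendScalars f
  have := h.preservesHomology_coextendScalars
  have := h.full
  refine qgldim_le_of_functor (coextendScalars f) h.projective_coextendScalars fun N hN =>
    ⟨(restrictScalars f).obj N, 1, finite_restrictScalars f h.surjective N hN, one_ne_zero, ?_⟩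
  exact (IsPower.one N).of_iso (asIso ((restrictCoextendScalarsAdj.{u, u, u} f).unit.app N)).symm

theorem qpd_restrictScalars_le (M : ModuleCat.{u} A) (hM : Module.Finite A M) :
    qpd ((restrictScalars f).obj ((coextendScalars f).obj M)) ≤ qgldim B := by
  have := h.projective
  exact (qpd_map_le (restrictScalars f) (projective_restrictScalars f) _).trans
    (le_iSup₂_of_le _ (h.finite_coextendScalars M hM) le_rfl)

end IsDirectFactor

/-- The inclusion of the first factor as a non-unital ring homomorphism. -/
def inlNonUnital (R S : Type u) [Ring R] [Ring S] : R →ₙ+* R × S where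
  toFun r := (r, 0)
  map_mul' := by simp
  map_zero' := rfl
  map_add' := by simp

/-- The inclusion of the second factor as a non-unital ring homomorphism. -/
def inrNonUnital (R S : Type u) [Ring R] [Ring S] : S →ₙ+* R × S where
  toFun s := (0, s)
  map_mul' := by simp
  map_zero' := rfl
  map_add' := by simp

theorem inlNonUnital_apply {R S : Type u} [Ring R] [Ring S] (r : R) :
    inlNonUnital R S r = (r, 0) := rfl

theorem inrNonUnital_apply {R S : Type u} [Ring R] [Ring S] (s : S) :
    inrNonUnital R S s = (0, s) := rfl

theorem isDirectFactor_fst (R S : Type u) [Ring R] [Ring S] :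
    IsDirectFactor (RingHom.fst R S) (inlNonUnital R S) where
  proj_incl _ := rfl
  incl_proj a := by ext <;> simp [inlNonUnital_apply]
  incl_proj' a := by ext <;> simp [inlNonUnital_apply]

theorem isDirectFactor_snd (R S : Type u) [Ring R] [Ring S] :
    IsDirectFactor (RingHom.snd R S) (inrNonUnital R S) where
  proj_incl _ := rfl
  incl_proj a := by ext <;> simp [inrNonUnital_apply]
  incl_proj' a := by ext <;> simp [inrNonUnital_apply]

open IsDirectFactor in
-- For ≤, the central idempotents (1, 0) and (0, 1) split M into the restrictions of its two
-- coextensions, and `qpd_biprod_le` applies. The reverse bound holds because R and S are direct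
-- factors.
theorem qgldim_prod (R S : Type u) [Ring R] [Ring S] :
    qgldim (R × S) = max (qgldim R) (qgldim S) := by
  have h1 := isDirectFactor_fst R S
  have h2 := isDirectFactor_snd R S
  refine le_antisymm (iSup₂_le fun M hM => ?_) (max_le h1.qgldim_le h2.qgldim_le)
  let p := (counitLinearMap (RingHom.fst R S) M).coprod
    (counitLinearMap (RingHom.snd R S) M)
  let s := (sectionLinearMap h1 M).prod (sectionLinearMap h2 M)
  have hps : p ∘ₗ s = LinearMap.id := by
    refine LinearMap.ext fun m => ?_
    change ((1, 0) : R × S) • m + ((0, 1) : R × S) • m = m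
    rw [← add_smul]
    simp [Prod.mk_one_one]
  have hsp : s ∘ₗ p = LinearMap.id := by
    -- The elements (r, 0) map to 0 in S, so they annihilate every module restricted from S; the
    -- other mixed term vanishes symmetrically.
    have h12 : sectionLinearMap h1 M ∘ₗ counitLinearMap (RingHom.snd R S) M = 0 := by
      refine LinearMap.ext fun g => CoextendScalars.ext (LinearMap.ext fun r => ?_)
      let x : (restrictScalars (RingHom.snd R S)).obj (of S S) := (1 : S)
      exact (((CoextendScalars.equiv _ M g).map_smul (inlNonUnital R S r) x).symm.trans
        (congrArg (CoextendScalars.equiv _ M g) (zero_mul (1 : S)))).trans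
          (map_zero (CoextendScalars.equiv _ M g))
    have h21 : sectionLinearMap h2 M ∘ₗ counitLinearMap (RingHom.fst R S) M = 0 := by
      refine LinearMap.ext fun g => CoextendScalars.ext (LinearMap.ext fun s => ?_)
      let x : (restrictScalars (RingHom.fst R S)).obj (of R R) := (1 : R)
      exact (((CoextendScalars.equiv _ M g).map_smul (inrNonUnital R S s) x).symm.trans
        (congrArg (CoextendScalars.equiv _ M g) (zero_mul (1 : R)))).trans
          (map_zero (CoextendScalars.equiv _ M g))
    rw [LinearMap.comp_coprod, LinearMap.prod_comp, LinearMap.prod_comp,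
      h1.sectionLinearMap_comp_counitLinearMap, h2.sectionLinearMap_comp_counitLinearMap, h12, h21]
    exact LinearMap.ext fun x => by ext <;> simp
  let e := (LinearEquiv.ofLinearMap p s hps hsp).toModuleIso
  rw [← qpd_eq_of_iso (ModuleCat.biprodIsoProd _ _ ≪≫ e)]
  exact (qpd_biprod_le _ _).trans
    (max_le_max (h1.qpd_restrictScalars_le M hM) (h2.qpd_restrictScalars_le M hM))

end DirectFactor

/-! ### Tensor products of finite-dimensional algebras -/

section TensorProduct

open ModuleCat

attribute [local instance] Abelian.hasFiniteBiproducts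

variable (K : Type v) [Field K] (R S : Type u) [Ring R] [Ring S] [Algebra K R] [Algebra K S]

section

variable (N : Type u) [AddCommGroup N] [Module K N] [Module R N] [IsScalarTower K R N]

/-- The action of `R ⊗[K] S` on `N ⊗[K] S`, for an `R`-module `N`. -/
def tensorAction : R ⊗[K] S →ₐ[K] Module.End K (N ⊗[K] S) :=
  Module.endTensorEndAlgHom.comp
    (Algebra.TensorProduct.map (Algebra.lsmul K K N) (Algebra.lsmul K K S))

theorem tensorAction_tmul (r : R) (s : S) (n : N) (t : S) :
    tensorAction K R S N (r ⊗ₜ s) (n ⊗ₜ t) = (r • n) ⊗ₜ (s * t) := rfl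

/-- The module `N ⊗[K] S` over `R ⊗[K] S`. -/
abbrev tensorModule : Module (R ⊗[K] S) (N ⊗[K] S) :=
  Module.compHom _ (tensorAction K R S N).toRingHom

end

/-- Take M = N ⊗ S. A basis of S over K identifies it over R with N^d for d = dim_K S, nonzero as S
is nontrivial, and the elements n ⊗ 1 with n in a generating set of N generate it over R ⊗ S. -/
theorem exists_module_tensor [FiniteDimensional K S] [Nontrivial S] (N : ModuleCat.{u} R)
    (hN : Module.Finite R N) :
    ∃ (M : ModuleCat.{u} (R ⊗[K] S)) (d : ℕ), Module.Finite (R ⊗[K] S) M ∧ d ≠ 0 ∧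
      IsPower N ((restrictScalars
        (Algebra.TensorProduct.includeLeftRingHom : R →+* R ⊗[K] S)).obj M) d := by
  let _ : Module K N := Module.compHom N (algebraMap K R)
  have : IsScalarTower K R N := ⟨fun k r n => by
    rw [Algebra.smul_def, mul_smul]; rfl⟩
  let _ := tensorModule K R S N
  have hsmul : ∀ (r : R) (s : S) (n : N) (t : S),
      (r ⊗ₜ[K] s) • (n ⊗ₜ[K] t) = (r • n) ⊗ₜ[K] (s * t) := tensorAction_tmul K R S N
  refine ⟨of (R ⊗[K] S) (N ⊗[K] S), Module.finrank K S, ?_, Module.finrank_pos.ne', ?_⟩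
  · obtain ⟨s, hs⟩ := hN.fg_top
    let j : N → N ⊗[K] S := fun n => n ⊗ₜ 1
    classical
    refine ⟨⟨s.image j, eq_top_iff.2 fun x _ => ?_⟩⟩
    have key : ∀ n : N, n ⊗ₜ[K] (1 : S) ∈
        Submodule.span (R ⊗[K] S) ((s.image j : Finset (N ⊗[K] S)) : Set (N ⊗[K] S)) := fun n => by
      have hn : n ∈ Submodule.span R (s : Set N) := hs ▸ Submodule.mem_top
      induction hn using Submodule.span_induction with
      | mem n h => exact Submodule.subset_span (Finset.mem_coe.2 (Finset.mem_image_of_mem j h))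
      | zero => rw [TensorProduct.zero_tmul]; exact Submodule.zero_mem _
      | add x y _ _ hx hy => rw [TensorProduct.add_tmul]; exact Submodule.add_mem _ hx hy
      | smul r n _ hn =>
        have h1 := hsmul r 1 n 1
        rw [one_mul] at h1
        exact h1 ▸ Submodule.smul_mem _ _ hn
    induction x using TensorProduct.induction_on with
    | zero => exact Submodule.zero_mem _
    | add x y hx hy => exact Submodule.add_mem _ (hx trivial) (hy trivial)
    | tmul n t =>
      have h1 := hsmul 1 t n 1
      rw [mul_one, one_smul] at h1
      exact h1 ▸ Submodule.smul_mem _ _ (key n)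
  · let b := Module.finBasis K S
    let e : N ⊗[K] S ≃ₗ[K] (Fin (Module.finrank K S) → N) :=
      (TensorProduct.congr (.refl K N) b.equivFun) ≪≫ₗ
        TensorProduct.piScalarRight K K N (Fin (Module.finrank K S))
    have he : ∀ (n : N) (t : S), e (n ⊗ₜ t) = fun j => b.equivFun t j • n := fun n t => rfl
    have hr : ∀ (r : R) (x : N ⊗[K] S), e ((r ⊗ₜ[K] (1 : S)) • x) = r • e x := fun r x => by
      induction x using TensorProduct.induction_on with
      | zero => rw [smul_zero, map_zero, smul_zero]
      | add x y hx hy => rw [smul_add, map_add, map_add, hx, hy, smul_add]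
      | tmul n t =>
        rw [hsmul, one_mul, he, he]
        funext j
        rw [Pi.smul_apply]
        exact smul_comm _ r n
    let e' : (restrictScalars (Algebra.TensorProduct.includeLeftRingHom : R →+* R ⊗[K] S)).obj
        (of (R ⊗[K] S) (N ⊗[K] S)) ≃ₗ[R] (Fin (Module.finrank K S) → N) :=
      { e.toAddEquiv with map_smul' := hr }
    exact ⟨e'.toModuleIso ≪≫ (biproductIsoPi fun _ => N).symm⟩

/-- R ⊗ S is a base change of the K-vector space S, hence projective over R; only the agreement of
the two R-actions needs checking. -/
theorem projective_tensor :
    Module.Projective R ((restrictScalars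
      (Algebra.TensorProduct.includeLeftRingHom : R →+* R ⊗[K] S)).obj
        (of (R ⊗[K] S) (R ⊗[K] S))) := by
  have h : Module.Projective R (R ⊗[K] S) := inferInstance
  let e : (R ⊗[K] S) ≃ₗ[R] ((restrictScalars
      (Algebra.TensorProduct.includeLeftRingHom : R →+* R ⊗[K] S)).obj
        (of (R ⊗[K] S) (R ⊗[K] S))) :=
    { AddEquiv.refl (R ⊗[K] S) with
      map_smul' := fun r x => by
        change r • x = (r ⊗ₜ[K] (1 : S)) * x
        induction x using TensorProduct.induction_on with
        | zero => rw [smul_zero, mul_zero]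
        | add x y hx hy => rw [smul_add, mul_add, hx, hy]
        | tmul a b =>
          rw [TensorProduct.smul_tmul', Algebra.TensorProduct.tmul_mul_tmul, one_mul,
            smul_eq_mul] }
  exact Module.Projective.of_equiv e

theorem qgldim_le_tensor_left [FiniteDimensional K S] [Nontrivial S] :
    qgldim R ≤ qgldim (R ⊗[K] S) :=
  have := projective_tensor K R S
  qgldim_le_of_functor _ (projective_restrictScalars _) (exists_module_tensor K R S)

theorem qgldim_le_tensor_right [FiniteDimensional K R] [Nontrivial R] :
    qgldim S ≤ qgldim (R ⊗[K] S) :=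
  (qgldim_le_tensor_left K S R).trans
    (qgldim_le_of_ringEquiv (Algebra.TensorProduct.comm K S R).toRingEquiv)

end TensorProduct

end QuasiProj

end

theorem proposition4p2 (R S : Type u) [Ring R] [Ring S]
    [IsNoetherianRing R] [IsNoetherianRing S] :
    -- the finitistic dimension through quasi-projective dimensions
    (QuasiProj.fdim R =
        ⨆ (M : ModuleCat.{u} R) (_ : Module.Finite R M) (_ : QuasiProj.qpd M < ⊤),
          QuasiProj.qpd M) ∧
    (QuasiProj.qgldim R < ⊤ → QuasiProj.fdim R = QuasiProj.qgldim R) ∧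
    -- Morita invariance
    (IsMoritaEquivalent ℤ R S → QuasiProj.qgldim R = QuasiProj.qgldim S) ∧
    -- products
    (QuasiProj.qgldim (R × S) = max (QuasiProj.qgldim R) (QuasiProj.qgldim S)) ∧
    -- tensor products of nonzero finite-dimensional algebras
    (∀ (K : Type v) [Field K] [Algebra K R] [Algebra K S]
        [FiniteDimensional K R] [FiniteDimensional K S] [Nontrivial R] [Nontrivial S],
      max (QuasiProj.qgldim R) (QuasiProj.qgldim S) ≤ QuasiProj.qgldim (R ⊗[K] S)) := by
  refine ⟨QuasiProj.fdim_eq R, QuasiProj.fdim_eq_qgldim R, fun ⟨⟨h⟩⟩ => ?_,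
    QuasiProj.qgldim_prod R S, fun K _ _ _ _ _ _ _ =>
      max_le (QuasiProj.qgldim_le_tensor_left K R S) (QuasiProj.qgldim_le_tensor_right K R S)⟩
  have : h.symm.eqv.functor.Additive := inferInstance
  exact le_antisymm (QuasiProj.qgldim_le_of_equivalence h.symm.eqv)
    (QuasiProj.qgldim_le_of_equivalence h.eqv)
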